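/- **Setting.** A partial linear space is a pair $\Pi=(P,\mathcal L)$, where $P$ is a non-empty set of points and $\mathcal L$ is a family of proper subsets of $P$ (lines), such that every line has at least two points, every point lies on a line, and two distinct points lie on at most one common line. Points are *collinear* if some line contains them. A *subspace* is a set of points that contains, with any two distinct collinear points, the line joining them; it is *singular* if any two distinct points of it are collinear. $\langle X\rangle$ is the smallest subspace containing $X$; $X$ is *independent* if $\langle X\rangle$ is not spanned by a proper subset of $X$; a *base* of a subspace $S$ is an independent subset of $S$ spanning $S$; and $\dim S=d$ means that $d+1$ is the smallest cardinality of a base of $S$ (so $\dim\emptyset=-1$). A *polar space* is a partial linear space in which every line has at least three points, no point is collinear with all other points, for every point $p$ and line $L$ the point $p$ is collinear with exactly one or with all points of $L$, and every flag (chain) of singular subspaces is finite. It has *rank* $n$ if its maximal singular subspaces have dimension $n-1$. We write $X\perp Y$ if every point of $X$ is collinear with every point of $Y$. Let $\Pi$ be a polar space of rank $n$. Let $\mathcal G_j(\Pi)$ be the set of $j$-dimensional singular subspaces of $\Pi$. For a singular subspace $N$ let $[N\rangle_j$ be the set of all $X\in\mathcal G_j(\Pi)$ with $N\subset X$ (inclusion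 need not be strict). For $0\le j\le n-2$: * $\Gamma_j(\Pi)$ is the graph with vertex set $\mathcal G_j(\Pi)$ in which $S,U$ are adjacent iff $\dim(S\cap U)=j-1$ and $S\perp U$; * $\mathfrak G_j(\Pi)$ is the partial linear space with point set $\mathcal G_j(\Pi)$ whose lines are the sets $\{X\in\mathcal G_j(\Pi): S\subset X\subset U\}$ with $S\in\mathcal G_{j-1}(\Pi)$, $U\in\mathcal G_{j+1}(\Pi)$, $S\subset U$; * a *top* of $\mathcal G_j(\Pi)$ is a set $\{X\in\mathcal G_j(\Pi): X\subset U\}$ with $U\in\mathcal G_{j+1}(\Pi)$; * if $N\in\mathcal G_{j-1}(\Pi)$, then $[N\rangle_j$, with the lines of $\mathfrak G_j(\Pi)$ contained in it, is a polar space of rank $n-j$. An *$l$-frame* of a polar space is a set of $2l$ points such that each of them is non-collinear with exactly one point of the set. A subset of $J=\{\pm1,\dots,\pm l\}$ is called singular if it does not contain both $j$ and $-j$ for any $j$. For $0\le m\le l-2$ the polar Johnson graph $PJ(l,m)$ has as vertices the singular $(m+1)$-element subsets of $J$; two of them are adjacent iff their intersection has $m$ elements and their union is singular. A *top* of $PJ(l,m)$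 consists of all vertices contained in a given singular $(m+2)$-element subset of $J$. An *embedding* of graphs is an injective map of vertex sets under which two vertices are adjacent if and only if their images are. **Theorem 4.4.** Let $\Pi$ be a polar space of rank $n$ and let $k,l,m$ be natural numbers with $$0<m\le k,\qquad l\le n,\qquad 3\le l-m\le n-k.$$ Let $f$ be an embedding of $PJ(l,m)$ in $\Gamma_k(\Pi)$ such that the image of every top of $PJ(l,m)$ is an independent subset of $\mathfrak G_k(\Pi)$ and is contained in a top of $\mathcal G_k(\Pi)$. Then there is a $(k-m-1)$-dimensional singular subspace $N$ of $\Pi$ such that the image of $f$ is contained in $[N\rangle_k$, and there is an $l$-frame $\mathcal B$ of the polar space $[N\rangle_{k-m}$ such that every element of the image of $f$ is spanned by elements of $\mathcal B$, that is, for every vertex $X$ of $PJ(l,m)$ there is a subset $\mathcal C\subset\mathcal B$ with $f(X)=\langle\bigcup\mathcal C\rangle$. -/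

import Mathlib

/-- A geometry of points and lines: a set of points together with a family of sets of points. -/
structure PointLine (α : Type*) where
  /-- the points -/
  points : Set α
  /-- the lines -/
  lines : Set (Set α)

namespace PointLine

variable {α : Type*} (G : PointLine α)

/-- Two points are collinear if some line contains both. In a partial linear space every point
lies on a line, so there this relation is reflexive. -/
def Collinear (p q : α) : Prop := ∃ L ∈ G.lines, p ∈ L ∧ q ∈ L

/-- Every point of `X` is collinear with every point of `Y`. -/
def Perp (X Y : Set α) : Prop := ∀ p ∈ X, ∀ q ∈ Y, G.Collinear p q

/-- A subspace contains, with any two distinct collinear points, every line joining them. -/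
def IsSubspace (S : Set α) : Prop :=
  S ⊆ G.points ∧ ∀ p ∈ S, ∀ q ∈ S, p ≠ q → ∀ L ∈ G.lines, p ∈ L → q ∈ L → L ⊆ S

/-- A singular subspace: any two distinct points of it are collinear. -/
def IsSingular (S : Set α) : Prop :=
  G.IsSubspace S ∧ ∀ p ∈ S, ∀ q ∈ S, p ≠ q → G.Collinear p q

/-- The subspace spanned by `X`: the intersection of all subspaces containing `X`. -/
def span (X : Set α) : Set α := ⋂₀ {S | G.IsSubspace S ∧ X ⊆ S}

/-- A set of points is independent if its span is not spanned by a proper subset of it. -/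
def IsIndependent (X : Set α) : Prop :=
  X ⊆ G.points ∧ ∀ Y, Y ⊂ X → G.span Y ≠ G.span X

/-- A base of `S` is an independent subset of `S` that spans `S`. -/
def IsBase (X S : Set α) : Prop := G.IsIndependent X ∧ X ⊆ S ∧ G.span X = S

/-- `S` has (finite) dimension `d`: `d + 1` is the smallest cardinality of a base of `S`.
The empty set has dimension `-1`, a point has dimension `0`. -/
def HasDim (S : Set α) (d : ℤ) : Prop :=
  IsLeast {e : ℤ | ∃ X : Finset α, G.IsBase (X : Set α) S ∧ (X.card : ℤ) = e + 1} d

/-- Partial linear spaces. -/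
structure IsPartialLinear : Prop where
  nonempty : G.points.Nonempty
  line_ssubset : ∀ L ∈ G.lines, L ⊂ G.points
  two_points : ∀ L ∈ G.lines, 2 ≤ L.encard
  exists_line : ∀ p ∈ G.points, ∃ L ∈ G.lines, p ∈ L
  line_unique : ∀ p q, p ≠ q → ∀ L ∈ G.lines, ∀ L' ∈ G.lines,
    p ∈ L → q ∈ L → p ∈ L' → q ∈ L' → L = L'

/-- Polar spaces. A flag is a set of mutually incident (comparable) singular subspaces. -/
structure IsPolarSpace : Prop extends G.IsPartialLinear where
  three_points : ∀ L ∈ G.lines, 3 ≤ L.encard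
  no_deep_point : ¬ ∃ p ∈ G.points, ∀ q ∈ G.points, q ≠ p → G.Collinear p q
  one_or_all : ∀ p ∈ G.points, ∀ L ∈ G.lines,
    (∃! q, q ∈ L ∧ G.Collinear p q) ∨ ∀ q ∈ L, G.Collinear p q
  finite_flag : ∀ F : Set (Set α), (∀ S ∈ F, G.IsSingular S) → IsChain (· ⊆ ·) F → F.Finite

/-- The polar space has rank `n`: its maximal singular subspaces have dimension `n - 1`
(in a polar space all of them have the same dimension, so it is enough to ask this of one). -/
def HasRank (n : ℕ) : Prop := ∃ M, Maximal G.IsSingular M ∧ G.HasDim M ((n : ℤ) - 1)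

/-- The Grassmannian of all `k`-dimensional singular subspaces. -/
def grassmannian (k : ℤ) : Set (Set α) := {S | G.IsSingular S ∧ G.HasDim S k}

/-- The set of all `k`-dimensional singular subspaces `X` with `S ⊆ X ⊆ U`. -/
def interval (S U : Set α) (k : ℤ) : Set (Set α) :=
  {X | X ∈ G.grassmannian k ∧ S ⊆ X ∧ X ⊆ U}

/-- The set of all `k`-dimensional singular subspaces containing `N`; for singular `N` this is
a parabolic subspace of the Grassmann space. -/
def parabolic (N : Set α) (k : ℤ) : Set (Set α) := {X | X ∈ G.grassmannian k ∧ N ⊆ X}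

/-- The top defined by `U`: all `k`-dimensional singular subspaces contained in `U`. -/
def top (U : Set α) (k : ℤ) : Set (Set α) := {X | X ∈ G.grassmannian k ∧ X ⊆ U}

/-- The polar Grassmann space of index `k` (for `k ≤ n - 2`, where `n` is the rank): its points
are the `k`-dimensional singular subspaces, its lines the intervals between incident singular
subspaces of dimensions `k - 1` and `k + 1`. -/
def grassmannSpace (k : ℤ) : PointLine (Set α) where
  points := G.grassmannian k
  lines := {L | ∃ S ∈ G.grassmannian (k - 1), ∃ U ∈ G.grassmannian (k + 1),
    S ⊆ U ∧ L = G.interval S U k}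

/-- The geometry induced on a set `X` of points: its lines are the lines contained in `X`. -/
def restrict (X : Set α) : PointLine α where
  points := G.points ∩ X
  lines := {L | L ∈ G.lines ∧ L ⊆ X}

/-- For `N` of dimension `j - 1`, the geometry induced by the Grassmann space of index `j` on the
set of all `j`-dimensional singular subspaces containing `N`; this is again a polar space. -/
def residue (N : Set α) (j : ℤ) : PointLine (Set α) :=
  (G.grassmannSpace j).restrict (G.parabolic N j)

/-- An `l`-frame: a set of `2 * l` points such that for every point of the set there is precisely
one point of the set not collinear with it. -/
def IsFrame (l : ℕ) (B : Set α) : Prop :=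
  B ⊆ G.points ∧ B.encard = (2 * l : ℕ) ∧ ∀ p ∈ B, ∃! q, q ∈ B ∧ ¬ G.Collinear p q

theorem HasDim.unique {G : PointLine α} {S : Set α} {d e : ℤ}
    (hd : G.HasDim S d) (he : G.HasDim S e) : d = e := IsLeast.unique hd he

/-- The Grassmann graph of `k`-dimensional singular subspaces in a polar space of rank `n`:
`S` and `U` are adjacent if their intersection has dimension `k - 1` and, in the case
`k ≤ n - 2`, moreover every point of `S` is collinear with every point of `U`. -/
def grassmannGraph (n : ℕ) (k : ℤ) : SimpleGraph (G.grassmannian k) where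
  Adj S U := G.HasDim (S.1 ∩ U.1) (k - 1) ∧ (k ≤ (n : ℤ) - 2 → G.Perp S.1 U.1)
  symm := ⟨by
    rintro S U ⟨h, h'⟩
    refine ⟨by rwa [Set.inter_comm], fun hk p hp q hq => ?_⟩
    obtain ⟨L, hL, h1, h2⟩ := h' hk q hq p hp
    exact ⟨L, hL, h2, h1⟩⟩
  loopless := ⟨by
    rintro S ⟨h, -⟩
    rw [Set.inter_self] at h
    have := h.unique S.2.2
    omega⟩

end PointLine

namespace PolarJohnson

/-- The index set `{1, …, n, -1, …, -n}`, an index with a sign, is `Fin n × Bool`; the negative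
of `(i, b)` is `(i, !b)`. A subset is singular if it contains no index together with its
negative. -/
def IsSingular {n : ℕ} (X : Finset (Fin n × Bool)) : Prop :=
  ∀ j ∈ X, (j.1, !j.2) ∉ X

/-- Vertices of `PJ(n, k)`: the singular subsets with `k + 1` elements. -/
abbrev Vertex (n k : ℕ) : Type :=
  {X : Finset (Fin n × Bool) // IsSingular X ∧ X.card = k + 1}

/-- The polar Johnson graph `PJ(n, k)`. -/
def graph (n k : ℕ) : SimpleGraph (Vertex n k) where
  Adj X Y := (X.1 ∩ Y.1).card = k ∧ (k + 2 ≤ n → IsSingular (X.1 ∪ Y.1))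
  symm := ⟨by
    rintro X Y ⟨h, h'⟩
    exact ⟨by rwa [Finset.inter_comm], by rwa [Finset.union_comm]⟩⟩
  loopless := ⟨by
    rintro X ⟨h, -⟩
    rw [Finset.inter_self, X.2.2] at h
    omega⟩

/-- The top of `PJ(n, k)` defined by a vertex `Z` of `PJ(n, k + 1)`. -/
def top {n k : ℕ} (Z : Vertex n (k + 1)) : Set (Vertex n k) := {X | X.1 ⊆ Z.1}

end PolarJohnson

namespace PointLine

variable {α : Type*} {G : PointLine α}

/-! ### Subspaces and spans -/

/-! For a singular index set `T`, let its core be the intersection of all `f X` with `T ⊆ X`.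
Everything follows once the core of `T` is known to have dimension `k - m - 1 + |T|` for `|T| ≤ m +
1`: `N` is the core of `∅`, the frame consists of the cores of the `2l` singletons, and adding
indices one at a time shows that `f X` is spanned by the cores of its elements.

The dimension is computed inside one top. For a singular `(m+2)`-set `Z`, the images of its vertices
are hyperplanes of one `(k+1)`-dimensional `U`; by duality, independence says that none of them
contains the intersection of the others (`exists_mem_notMem_of_isIndependent`). Hence each index
added to `T` raises by one the dimension of the local core, the intersection of the hyperplanes
indexed by `Z \ T`.

The crux is that the local core does not depend on `Z` (`localCore_subset`). Let two tops share the
vertex `X`. Three mutually adjacent images either share a `(k-1)`-space or force both tops into the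
same `U`; the latter makes non-adjacent vertices adjacent (`inter_subset`, `not_common_top`).
Exchanging single indices then connects any two tops.

Cores of opposite indices are not perpendicular, since otherwise two vertices differing only in the
sign of one index would become adjacent (`not_perp_core`).

The projective geometry of singular subspaces comes from the polar axioms: two disjoint maximal
singular subspaces are dual to each other under perp (`mem_of_biperp`), so adding a point to a
subspace makes it a hyperplane of the span. -/

theorem Collinear.symm {p q : α} (h : G.Collinear p q) : G.Collinear q p := by
  obtain ⟨L, hL, h1, h2⟩ := h
  exact ⟨L, hL, h2, h1⟩

theorem subset_span (X : Set α) : X ⊆ G.span X :=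
  Set.subset_sInter fun _ hS => hS.2

theorem span_subset {X S : Set α} (hS : G.IsSubspace S) (h : X ⊆ S) : G.span X ⊆ S :=
  Set.sInter_subset_of_mem ⟨hS, h⟩

theorem span_mono {X Y : Set α} (h : X ⊆ Y) : G.span X ⊆ G.span Y :=
  Set.subset_sInter fun _ hS => Set.sInter_subset_of_mem ⟨hS.1, h.trans hS.2⟩

theorem IsSubspace.span_eq {S : Set α} (hS : G.IsSubspace S) : G.span S = S :=
  (span_subset hS subset_rfl).antisymm (subset_span S)

theorem isSubspace_empty : G.IsSubspace ∅ :=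
  ⟨Set.empty_subset _, fun _ hp => hp.elim⟩

theorem isSingular_empty : G.IsSingular ∅ :=
  ⟨isSubspace_empty, fun _ hp => hp.elim⟩

theorem IsSubspace.inter {S T : Set α} (hS : G.IsSubspace S) (hT : G.IsSubspace T) :
    G.IsSubspace (S ∩ T) :=
  ⟨Set.inter_subset_left.trans hS.1, fun p hp q hq hpq L hL h1 h2 =>
    Set.subset_inter (hS.2 p hp.1 q hq.1 hpq L hL h1 h2) (hT.2 p hp.2 q hq.2 hpq L hL h1 h2)⟩

theorem IsSingular.mono {S T : Set α} (hS : G.IsSingular S) (hT : G.IsSubspace T) (h : T ⊆ S) :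
    G.IsSingular T :=
  ⟨hT, fun p hp q hq => hS.2 p (h hp) q (h hq)⟩

namespace IsPartialLinear

variable (hG : G.IsPartialLinear)
include hG

theorem isSubspace_points : G.IsSubspace G.points :=
  ⟨subset_rfl, fun _ _ _ _ _ L hL _ _ => (hG.line_ssubset L hL).1⟩

theorem isSubspace_span {X : Set α} (hX : X ⊆ G.points) : G.IsSubspace (G.span X) := by
  refine ⟨span_subset hG.isSubspace_points hX, fun p hp q hq hpq L hL h1 h2 => ?_⟩
  exact Set.subset_sInter fun S hS => hS.1.2 p (hp S hS) q (hq S hS) hpq L hL h1 h2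

theorem collinear_self {p : α} (hp : p ∈ G.points) : G.Collinear p p := by
  obtain ⟨L, hL, h⟩ := hG.exists_line p hp
  exact ⟨L, hL, h, h⟩

theorem mem_points_of_collinear {p q : α} (h : G.Collinear p q) : q ∈ G.points := by
  obtain ⟨L, hL, -, h⟩ := h
  exact (hG.line_ssubset L hL).1 h

end IsPartialLinear

theorem IsSingular.collinear (hG : G.IsPartialLinear) {S : Set α} (hS : G.IsSingular S) {p q : α}
    (hp : p ∈ S) (hq : q ∈ S) : G.Collinear p q := by
  by_cases h : p = q
  · subst h
    exact hG.collinear_self (hS.1.1 hp)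
  · exact hS.2 p hp q hq h

theorem IsSingular.exists_line {S : Set α} (hS : G.IsSingular S) {p q : α}
    (hp : p ∈ S) (hq : q ∈ S) (h : p ≠ q) : ∃ L ∈ G.lines, p ∈ L ∧ q ∈ L ∧ L ⊆ S := by
  obtain ⟨L, hL, h1, h2⟩ := hS.2 p hp q hq h
  exact ⟨L, hL, h1, h2, hS.1.2 p hp q hq h L hL h1 h2⟩

/-! ### Polar spaces -/

namespace IsPolarSpace

variable (hG : G.IsPolarSpace)
include hG

theorem exists_mem_line_collinear {p : α} (hp : p ∈ G.points) {L : Set α} (hL : L ∈ G.lines) :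
    ∃ q ∈ L, G.Collinear p q := by
  rcases hG.one_or_all p hp L hL with ⟨q, hq, -⟩ | h
  · exact ⟨q, hq.1, hq.2⟩
  · have h2 := hG.two_points L hL
    obtain ⟨q, hq⟩ : L.Nonempty := by
      rw [Set.nonempty_iff_ne_empty]
      rintro rfl
      simp at h2
    exact ⟨q, hq, h q hq⟩

theorem isSubspace_perp (p : α) : G.IsSubspace {q | G.Collinear p q} := by
  refine ⟨fun q hq => hG.mem_points_of_collinear hq, fun x hx y hy hxy L hL hxL hyL => ?_⟩
  have hp := hG.mem_points_of_collinear hx.symm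
  rcases hG.one_or_all p hp L hL with h | h
  · exact absurd (h.unique ⟨hxL, hx⟩ ⟨hyL, hy⟩) hxy
  · exact h

theorem collinear_of_mem_span {X : Set α} {p q : α} (h : ∀ x ∈ X, G.Collinear p x)
    (hq : q ∈ G.span X) : G.Collinear p q :=
  span_subset (hG.isSubspace_perp p) h hq

theorem isSingular_span {X : Set α} (hX : X ⊆ G.points)
    (h : ∀ p ∈ X, ∀ q ∈ X, G.Collinear p q) : G.IsSingular (G.span X) := by
  refine ⟨hG.isSubspace_span hX, fun p hp q hq _ => ?_⟩
  exact hG.collinear_of_mem_span (fun x hx => (hG.collinear_of_mem_span (h x hx) hp).symm) hq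

theorem isSingular_span_insert {S : Set α} (hS : G.IsSingular S) {p : α} (hp : p ∈ G.points)
    (h : ∀ q ∈ S, G.Collinear p q) : G.IsSingular (G.span (insert p S)) := by
  refine hG.isSingular_span (Set.insert_subset hp hS.1.1) ?_
  rintro x (rfl | hx) y (rfl | hy)
  · exact hG.collinear_self hp
  · exact h y hy
  · exact (h x hx).symm
  · exact hS.collinear hG.toIsPartialLinear hx hy

theorem mem_of_maximal {M : Set α} (hM : Maximal G.IsSingular M) {p : α} (hp : p ∈ G.points)
    (h : ∀ q ∈ M, G.Collinear p q) : p ∈ M :=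
  hM.2 (hG.isSingular_span_insert hM.1 hp h)
    ((Set.subset_insert p M).trans (subset_span _)) (subset_span _ (Set.mem_insert p M))

/-- Without a maximal member, one could ascend forever, and the chain would be an infinite flag. -/
theorem exists_maximal (P : Set α → Prop) (hP : ∀ S, P S → G.IsSingular S) {S₀ : Set α}
    (h₀ : P S₀) : ∃ S, Maximal P S := by
  by_contra! hno
  have key : ∀ S : {S // P S}, ∃ T : {S // P S}, S.1 ⊂ T.1 := fun S => by
    have := hno S.1
    rw [not_maximal_iff S.2] at this
    obtain ⟨T, hT, hST⟩ := this
    exact ⟨⟨T, hT⟩, hST⟩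
  choose nxt hnxt using key
  let s : ℕ → {S // P S} := fun i => nxt^[i] ⟨S₀, h₀⟩
  have hs : StrictMono fun i => (s i).1 := strictMono_nat_of_lt_succ fun i => by
    simp only [s, Function.iterate_succ_apply']
    exact hnxt _
  refine Set.infinite_range_of_injective hs.injective (hG.finite_flag _ ?_ ?_)
  · rintro _ ⟨i, rfl⟩
    exact hP _ (s i).2
  · exact hs.monotone.isChain_range

theorem exists_minimal (P : Set α → Prop) (hP : ∀ S, P S → G.IsSingular S) {S₀ : Set α}
    (h₀ : P S₀) : ∃ S, Minimal P S := by
  by_contra! hno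
  have key : ∀ S : {S // P S}, ∃ T : {S // P S}, T.1 ⊂ S.1 := fun S => by
    have := hno S.1
    rw [not_minimal_iff S.2] at this
    obtain ⟨T, hT, hST⟩ := this
    exact ⟨⟨T, hT⟩, hST⟩
  choose nxt hnxt using key
  let s : ℕ → {S // P S} := fun i => nxt^[i] ⟨S₀, h₀⟩
  have hs : StrictAnti fun i => (s i).1 := strictAnti_nat_of_succ_lt fun i => by
    simp only [s, Function.iterate_succ_apply']
    exact hnxt _
  refine Set.infinite_range_of_injective hs.injective (hG.finite_flag _ ?_ ?_)
  · rintro _ ⟨i, rfl⟩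
    exact hP _ (s i).2
  · rintro _ ⟨i, rfl⟩ _ ⟨j, rfl⟩ -
    rcases le_total i j with h | h
    · exact Or.inr (hs.antitone h)
    · exact Or.inl (hs.antitone h)

theorem exists_maximal_singular {S : Set α} (hS : G.IsSingular S) :
    ∃ M, Maximal G.IsSingular M ∧ S ⊆ M := by
  obtain ⟨M, hM⟩ := hG.exists_maximal (fun T => G.IsSingular T ∧ S ⊆ T) (fun _ h => h.1)
    ⟨hS, subset_rfl⟩
  exact ⟨M, ⟨hM.1.1, fun T hT hMT => hM.2 ⟨hT, hM.1.2.trans hMT⟩ hMT⟩, hM.1.2⟩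

/-- In a singular subspace `S` not contained in `p^⊥`, the set `S ∩ p^⊥` is a maximal proper
subspace. -/
theorem subset_of_perp_subset {S C : Set α} (hS : G.IsSingular S) (hC : G.IsSubspace C) {p x : α}
    (hp : p ∈ G.points) (hxS : x ∈ S) (hxC : x ∈ C) (hpx : ¬ G.Collinear p x)
    (h : ∀ u ∈ S, G.Collinear p u → u ∈ C) : S ⊆ C := by
  intro u hu
  by_cases hpu : G.Collinear p u
  · exact h u hu hpu
  by_cases hux : u = x
  · exact hux ▸ hxC
  obtain ⟨L, hL, huL, hxL, hLS⟩ := hS.exists_line hu hxS hux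
  obtain ⟨v, hvL, hpv⟩ := hG.exists_mem_line_collinear hp hL
  have hvx : v ≠ x := fun e => hpx (e ▸ hpv)
  exact hC.2 v (h v (hLS hvL) hpv) x hxC hvx L hL hvL hxL huL

/-- Every maximal singular subspace is disjoint from some maximal singular subspace. -/
theorem exists_disjoint_maximal {M : Set α} (hM : Maximal G.IsSingular M) :
    ∃ M', Maximal G.IsSingular M' ∧ Disjoint M M' := by
  obtain ⟨I, ⟨M', hM', rfl⟩, hmin⟩ := hG.exists_minimal
    (fun I => ∃ M', Maximal G.IsSingular M' ∧ I = M ∩ M')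
    (by rintro _ ⟨M', hM', rfl⟩; exact hM.1.mono (hM.1.1.inter hM'.1.1) Set.inter_subset_left)
    ⟨M, hM, rfl⟩
  refine ⟨M', hM', Set.disjoint_iff_forall_ne.2 ?_⟩
  rintro p hpM _ hpM' rfl
  have hp := hM.1.1.1 hpM
  obtain ⟨q, hq, hpq⟩ : ∃ q ∈ G.points, ¬ G.Collinear q p := by
    by_contra! h
    exact hG.no_deep_point ⟨p, hp, fun q hq _ => (h q hq).symm⟩
  have hH : G.IsSingular ({x | G.Collinear q x} ∩ M') :=
    hM'.1.mono ((hG.isSubspace_perp q).inter hM'.1.1) Set.inter_subset_right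
  obtain ⟨M'', hM'', hsub⟩ := hG.exists_maximal_singular
    (hG.isSingular_span_insert hH hq fun x hx => hx.1)
  have hqM'' : q ∈ M'' := hsub (subset_span _ (Set.mem_insert _ _))
  have hHM'' : ∀ x ∈ M', G.Collinear q x → x ∈ M'' := fun x hx hqx =>
    hsub (subset_span _ (Set.mem_insert_of_mem _ ⟨hqx, hx⟩))
  -- A common point of `M` and `M''` is collinear with `p` and with all of `q^⊥ ∩ M'`, hence with
  -- all of `M'`. As `p` itself is not in `M''`, the intersection shrinks, against minimality.
  have hle : M ∩ M'' ⊆ M ∩ M' := by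
    rintro s ⟨hsM, hsM''⟩
    refine ⟨hsM, hG.mem_of_maximal hM' (hM.1.1.1 hsM) ?_⟩
    refine hG.subset_of_perp_subset hM'.1 (hG.isSubspace_perp s) hq hpM' ?_ hpq fun u hu hqu => ?_
    · exact hM.1.collinear hG.toIsPartialLinear hsM hpM
    · exact hM''.1.collinear hG.toIsPartialLinear hsM'' (hHM'' u hu hqu)
  have := hmin ⟨M'', hM'', rfl⟩ hle ⟨hpM, hpM'⟩
  exact hpq (hM''.1.collinear hG.toIsPartialLinear hqM'' this.2)

/-- For disjoint maximal singular subspaces `M` and `M'`, every subspace of `M` is determined by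
the points of `M'` collinear with all its points. -/
theorem mem_of_biperp {M M' : Set α} (hM : Maximal G.IsSingular M) (hM' : Maximal G.IsSingular M')
    (hd : Disjoint M M') {A : Set α} (hA : G.IsSubspace A) (hAM : A ⊆ M) {y : α} (hyM : y ∈ M)
    (hy : ∀ x ∈ M', (∀ a ∈ A, G.Collinear a x) → G.Collinear y x) : y ∈ A := by
  -- Closed means equal to the double perp taken through `M'`. The empty set is closed because `M`
  -- and `M'` are disjoint, and adding a point preserves closedness, so a maximal closed subspace of
  -- `A` is `A`.
  let closed : Set α → Prop := fun A => ∀ y ∈ M,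
    (∀ x ∈ M', (∀ a ∈ A, G.Collinear a x) → G.Collinear y x) → y ∈ A
  have h_empty : closed ∅ := fun y hyM hy =>
    (Set.disjoint_left.1 hd hyM (hG.mem_of_maximal hM' (hM.1.1.1 hyM)
      fun x hx => hy x hx (by simp))).elim
  have h_insert : ∀ A, G.IsSubspace A → A ⊆ M → closed A → ∀ p ∈ M, p ∉ A →
      closed (G.span (insert p A)) := by
    intro A hA hAM hcl p hpM hpA y hyM hy
    have hp := hM.1.1.1 hpM
    have : ¬ ∀ x ∈ M', (∀ a ∈ A, G.Collinear a x) → G.Collinear p x := fun h =>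
      hpA (hcl p hpM h)
    push Not at this
    obtain ⟨x₀, hx₀, hx₀A, hpx₀⟩ := this
    by_cases hyp : p = y
    · exact hyp ▸ subset_span _ (Set.mem_insert _ _)
    obtain ⟨L, hL, hpL, hyL, hLM⟩ := hM.1.exists_line hpM hyM hyp
    -- This `w` is collinear with `x₀` and with `p^⊥ ∩ A^⊥ ∩ M'`, hence with all of `A^⊥ ∩ M'`; so
    -- `w ∈ A`, and `y` lies on the line `wp`.
    obtain ⟨w, hwL, hw⟩ := hG.exists_mem_line_collinear (hM'.1.1.1 hx₀) hL
    have hwp : w ≠ p := fun e => hpx₀ (e ▸ hw.symm)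
    have hS : G.IsSubspace ({x | x ∈ M' ∧ ∀ a ∈ A, G.Collinear a x}) :=
      ⟨fun x hx => hM'.1.1.1 hx.1, fun x hx z hz hxz K hK hxK hzK u hu =>
        ⟨hM'.1.1.2 x hx.1 z hz.1 hxz K hK hxK hzK hu, fun a ha =>
          (hG.isSubspace_perp a).2 x (hx.2 a ha) z (hz.2 a ha) hxz K hK hxK hzK hu⟩⟩
    have hwA : w ∈ A := by
      refine hcl w (hLM hwL) fun x hx hxA => ?_
      refine hG.subset_of_perp_subset (hM'.1.mono hS fun x hx => hx.1) (hG.isSubspace_perp w) hp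
        (x := x₀) ⟨hx₀, hx₀A⟩ hw.symm hpx₀ (fun u hu hpu => ?_) ⟨hx, hxA⟩
      have hyu : G.Collinear y u := hy u hu.1 fun a ha =>
        (hG.collinear_of_mem_span (p := u) (by
          rintro b (rfl | hb)
          · exact hpu.symm
          · exact (hu.2 b hb).symm) ha).symm
      exact Collinear.symm ((hG.isSubspace_perp u).2 p hpu.symm y hyu.symm hyp L hL hpL hyL hwL)
    exact (hG.isSubspace_span (Set.insert_subset hp hA.1)).2 w
      (subset_span _ (Set.mem_insert_of_mem _ hwA)) p (subset_span _ (Set.mem_insert _ _)) hwp L hL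
      hwL hpL hyL
  obtain ⟨B, ⟨hB, hBA, hBc⟩, hmax⟩ := hG.exists_maximal
    (fun B => G.IsSubspace B ∧ B ⊆ A ∧ closed B)
    (fun B hB => hM.1.mono hB.1 (hB.2.1.trans hAM)) (S₀ := ∅)
    ⟨isSubspace_empty, Set.empty_subset _, h_empty⟩
  have hAB : A ⊆ B := by
    intro p hpA
    by_contra hpB
    have hsub : insert p B ⊆ A := Set.insert_subset hpA hBA
    exact hpB (hmax ⟨hG.isSubspace_span (hsub.trans hA.1), span_subset hA hsub,
      h_insert B hB (hBA.trans hAM) hBc p (hAM hpA) hpB⟩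
      ((Set.subset_insert p B).trans (subset_span _)) (subset_span _ (Set.mem_insert _ _)))
  exact hBA (hBc y hyM fun x hx h => hy x hx fun a ha => h a (hAB ha))

/-- Duality gives a point `x₀` outside `S` that is collinear with all of `A` but not with `p`. The
points of `S` collinear with `x₀` all lie in `A`, and each line contains a point collinear with
`x₀`. -/
theorem exists_mem_line_of_subset_span_insert {S A : Set α} (hS : G.IsSingular S)
    (hA : G.IsSubspace A) (hAS : A ⊆ S) {p : α} (hpS : p ∈ S) (hspan : S ⊆ G.span (insert p A))
    (hpA : p ∉ A) {L : Set α} (hL : L ∈ G.lines) (hLS : L ⊆ S) : ∃ z ∈ L, z ∈ A := by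
  obtain ⟨M, hM, hSM⟩ := hG.exists_maximal_singular hS
  obtain ⟨M', hM', hd⟩ := hG.exists_disjoint_maximal hM
  have : ¬ ∀ x ∈ M', (∀ a ∈ A, G.Collinear a x) → G.Collinear p x := fun h =>
    hpA (hG.mem_of_biperp hM hM' hd hA (hAS.trans hSM) (hSM hpS) h)
  push Not at this
  obtain ⟨x₀, hx₀, hx₀A, hpx₀⟩ := this
  obtain ⟨z, hzL, hz⟩ := hG.exists_mem_line_collinear (hM'.1.1.1 hx₀) hL
  refine ⟨z, hzL, hG.mem_of_biperp hM hM' hd hA (hAS.trans hSM) (hSM (hLS hzL)) fun x hx hxA => ?_⟩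
  have hT : G.IsSubspace ({x | x ∈ M' ∧ ∀ a ∈ A, G.Collinear a x}) :=
    ⟨fun x hx => hM'.1.1.1 hx.1, fun x hx z hz hxz K hK hxK hzK u hu =>
      ⟨hM'.1.1.2 x hx.1 z hz.1 hxz K hK hxK hzK hu, fun a ha =>
        (hG.isSubspace_perp a).2 x (hx.2 a ha) z (hz.2 a ha) hxz K hK hxK hzK hu⟩⟩
  refine hG.subset_of_perp_subset (hM'.1.mono hT fun x hx => hx.1) (hG.isSubspace_perp z)
    (hS.1.1 hpS) (x := x₀) ⟨hx₀, hx₀A⟩ hz.symm hpx₀ (fun u hu hpu => ?_) ⟨hx, hxA⟩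
  refine (hG.collinear_of_mem_span (p := u) ?_ (hspan (hLS hzL))).symm
  rintro b (rfl | hb)
  · exact hpu.symm
  · exact (hu.2 b hb).symm

end IsPolarSpace

/-! ### Hyperplanes of singular subspaces and dimension -/

/-- A hyperplane of a singular subspace: a proper subspace meeting every line. -/
structure IsHyperplane (G : PointLine α) (A S : Set α) : Prop where
  singular : G.IsSingular S
  subspace : G.IsSubspace A
  ssubset : A ⊂ S
  meets : ∀ L ∈ G.lines, L ⊆ S → ∃ z ∈ L, z ∈ A

namespace IsHyperplane

variable {A B D S : Set α}

/-- The line from `p` to any other point of `S` has a second point in `A`, so hyperplanes are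
maximal proper subspaces. -/
theorem subset_of_mem (h : G.IsHyperplane A S) (hD : G.IsSubspace D) (hAD : A ⊆ D) {p : α}
    (hpS : p ∈ S) (hpA : p ∉ A) (hpD : p ∈ D) : S ⊆ D := by
  intro q hq
  by_cases hqp : q = p
  · exact hqp ▸ hpD
  obtain ⟨L, hL, hqL, hpL, hLS⟩ := h.singular.exists_line hq hpS hqp
  obtain ⟨z, hzL, hzA⟩ := h.meets L hL hLS
  exact hD.2 z (hAD hzA) p hpD (fun e => hpA (e ▸ hzA)) L hL hzL hpL hqL

theorem inter (h : G.IsHyperplane A S) (hD : G.IsSubspace D) (hDS : D ⊆ S) (hDA : ¬ D ⊆ A) :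
    G.IsHyperplane (D ∩ A) D where
  singular := h.singular.mono hD hDS
  subspace := hD.inter h.subspace
  ssubset := ⟨Set.inter_subset_left, fun h' => hDA (h'.trans Set.inter_subset_right)⟩
  meets L hL hLD := by
    obtain ⟨z, hzL, hzA⟩ := h.meets L hL (hLD.trans hDS)
    exact ⟨z, hzL, hLD hzL, hzA⟩

theorem eq_of_subset (hA : G.IsHyperplane A S) (hB : G.IsHyperplane B S) (h : A ⊆ B) : A = B := by
  refine h.antisymm fun p hp => ?_
  by_contra hpA
  exact hB.ssubset.2 (hA.subset_of_mem hB.subspace h (hB.ssubset.1 hp) hpA hp)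

end IsHyperplane

theorem IsPolarSpace.isHyperplane_span_insert (hG : G.IsPolarSpace) {A : Set α} {p : α}
    (hA : G.IsSubspace A) (hpA : p ∉ A) (hS : G.IsSingular (G.span (insert p A))) :
    G.IsHyperplane A (G.span (insert p A)) where
  singular := hS
  subspace := hA
  ssubset := ⟨(Set.subset_insert _ _).trans (subset_span _), fun h =>
    hpA (h (subset_span _ (Set.mem_insert _ _)))⟩
  meets _ hL hLS := hG.exists_mem_line_of_subset_span_insert hS hA
    ((Set.subset_insert _ _).trans (subset_span _)) (subset_span _ (Set.mem_insert _ _))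
    subset_rfl hpA hL hLS

/-- `G.HasLength S r`: there is a chain of length `r` from the empty subspace to `S`
each member of which is a hyperplane of the next. -/
inductive HasLength (G : PointLine α) : Set α → ℕ → Prop
  | empty : HasLength G ∅ 0
  | step {A S : Set α} {r : ℕ} : G.IsHyperplane A S → HasLength G A r → HasLength G S (r + 1)

theorem HasLength.singular {S : Set α} {r : ℕ} (h : G.HasLength S r) : G.IsSingular S := by
  cases h with
  | empty => exact isSingular_empty
  | step h _ => exact h.singular

/-- The Jordan–Hölder exchange: two distinct hyperplanes `A`, `B` of `S` have `A ∩ B` as a common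
hyperplane, through which the chain can be rerouted. -/
theorem HasLength.hyperplane {S : Set α} {r : ℕ} (h : G.HasLength S r) :
    ∀ A, G.IsHyperplane A S → ∃ s, r = s + 1 ∧ G.HasLength A s := by
  induction h with
  | empty => exact fun A hA => (hA.ssubset.2 (Set.empty_subset _)).elim
  | @step B S r hB hlen ih =>
    intro A hA
    refine ⟨r, rfl, ?_⟩
    by_cases hBA : B ⊆ A
    · exact hB.eq_of_subset hA hBA ▸ hlen
    have hAB : ¬ A ⊆ B := fun h => hBA (hA.eq_of_subset hB h).ge
    obtain ⟨s, rfl, hs⟩ := ih _ (hA.inter hB.subspace hB.ssubset.1 hBA)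
    refine HasLength.step (hB.inter hA.subspace hA.ssubset.1 hAB) ?_
    rwa [Set.inter_comm]

theorem HasLength.unique {S : Set α} {r s : ℕ} (hr : G.HasLength S r) (hs : G.HasLength S s) :
    r = s := by
  induction hr generalizing s with
  | empty =>
    cases hs with
    | empty => rfl
    | step h _ => exact (h.ssubset.2 (Set.empty_subset _)).elim
  | step h _ ih =>
    obtain ⟨t, rfl, ht⟩ := hs.hyperplane _ h
    rw [ih ht]

/-- Intersecting a chain with `A` turns each step into a hyperplane or an equality; full length
means that no step collapses. -/
theorem HasLength.subspace {S : Set α} {r : ℕ} (h : G.HasLength S r) :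
    ∀ A, G.IsSubspace A → A ⊆ S → ∃ s ≤ r, G.HasLength A s ∧ (s = r → A = S) := by
  induction h with
  | empty =>
    intro A _ h
    obtain rfl := Set.subset_empty_iff.1 h
    exact ⟨0, le_rfl, .empty, fun _ => rfl⟩
  | @step B S r hB hlen ih =>
    intro A hA hAS
    by_cases hAB : A ⊆ B
    · obtain ⟨s, hs, hl, -⟩ := ih A hA hAB
      exact ⟨s, by omega, hl, by omega⟩
    · obtain ⟨s, hs, hl, heq⟩ := ih (A ∩ B) (hA.inter hB.subspace) Set.inter_subset_right
      refine ⟨s + 1, by omega, .step (hB.inter hA hAS hAB) hl, fun h => hAS.antisymm ?_⟩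
      have hBA : B ⊆ A := Set.inter_eq_right.1 (heq (by omega))
      obtain ⟨p, hpA, hpB⟩ := Set.not_subset.1 hAB
      exact hB.subset_of_mem hA hBA (hAS hpA) hpB hpA

/-! ### Length, bases and dimension -/

namespace IsPolarSpace

variable (hG : G.IsPolarSpace)
include hG

theorem exists_hasLength {S : Set α} (hS : G.IsSingular S) : ∃ r, G.HasLength S r := by
  obtain ⟨A, ⟨hAS, r, hr⟩, hmax⟩ := hG.exists_maximal
    (fun A => A ⊆ S ∧ ∃ r, G.HasLength A r) (fun A h => h.2.choose_spec.singular) (S₀ := ∅)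
    ⟨Set.empty_subset _, 0, .empty⟩
  suffices S ⊆ A from ⟨r, this.antisymm hAS ▸ hr⟩
  intro p hp
  by_contra hpA
  have hsub : G.span (insert p A) ⊆ S := span_subset hS.1 (Set.insert_subset hp hAS)
  have hsing := hS.mono (hG.isSubspace_span ((Set.insert_subset hp hAS).trans hS.1.1)) hsub
  exact hpA (hmax ⟨hsub, r + 1, .step (hG.isHyperplane_span_insert hr.singular.1 hpA hsing) hr⟩
    ((Set.subset_insert _ _).trans (subset_span _)) (subset_span _ (Set.mem_insert _ _)))

theorem notMem_span_of_isIndependent {X : Set α} (hX : G.IsIndependent X) {x : α} (hx : x ∈ X) :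
    x ∉ G.span (X \ {x}) := by
  intro h
  refine hX.2 (X \ {x}) ⟨Set.sdiff_subset, fun h' => (h' hx).2 rfl⟩
    ((span_mono Set.sdiff_subset).antisymm ?_)
  refine span_subset (hG.isSubspace_span (Set.sdiff_subset.trans hX.1)) fun y hy => ?_
  by_cases hyx : y = x
  · exact hyx ▸ h
  · exact subset_span _ ⟨hy, hyx⟩

theorem hasLength_span (X : Finset α) (hX : (X : Set α) ⊆ G.points)
    (hs : G.IsSingular (G.span X)) (hi : ∀ x ∈ X, x ∉ G.span ((X : Set α) \ {x})) :
    G.HasLength (G.span X) X.card := by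
  classical
  induction X using Finset.induction_on with
  | empty =>
    rw [Finset.coe_empty, isSubspace_empty.span_eq]
    exact .empty
  | insert a X ha ih =>
    rw [Finset.coe_insert] at hX hs hi ⊢
    have hX' := (Set.subset_insert a (X : Set α)).trans hX
    have hsub : G.IsSubspace (G.span (X : Set α)) := hG.isSubspace_span hX'
    have hle : G.span (X : Set α) ⊆ G.span (insert a X) := span_mono (Set.subset_insert _ _)
    have haX : a ∉ G.span (X : Set α) := by
      have := hi a (Finset.mem_insert_self _ _)
      rwa [Set.insert_sdiff_self_of_notMem (by simpa using ha)] at this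
    have heq : G.span (insert a (X : Set α)) = G.span (insert a (G.span (X : Set α))) := by
      refine (span_mono (Set.insert_subset_insert (subset_span _))).antisymm
        (span_subset hs.1 (Set.insert_subset (subset_span _ (Set.mem_insert _ _)) hle))
    rw [Finset.card_insert_of_notMem ha]
    refine .step ?_ (ih hX' (hs.mono hsub hle) fun x hx h =>
      hi x (Finset.mem_insert_of_mem hx)
        (span_mono (Set.sdiff_subset_sdiff_left (Set.subset_insert _ _)) h))
    rw [heq] at hs ⊢
    exact hG.isHyperplane_span_insert hsub haX hs

theorem hasLength_of_isBase {X : Finset α} {S : Set α} (hS : G.IsSingular S)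
    (hX : G.IsBase (X : Set α) S) : G.HasLength S X.card := by
  obtain ⟨hi, -, rfl⟩ := hX
  exact hG.hasLength_span X hi.1 hS fun x hx => hG.notMem_span_of_isIndependent hi hx

end IsPolarSpace

theorem HasLength.exists_finset (hG : G.IsPolarSpace) {S : Set α} {r : ℕ} (h : G.HasLength S r) :
    ∃ X : Finset α, G.span (X : Set α) = S := by
  classical
  induction h with
  | empty => exact ⟨∅, by rw [Finset.coe_empty, isSubspace_empty.span_eq]⟩
  | @step A S r hA _ ih =>
    obtain ⟨X, rfl⟩ := ih
    obtain ⟨p, hpS, hpA⟩ := Set.exists_of_ssubset hA.ssubset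
    have hsub : ((insert p X : Finset α) : Set α) ⊆ S := by
      rw [Finset.coe_insert]
      exact Set.insert_subset hpS ((subset_span _).trans hA.ssubset.1)
    have hXp : X ⊆ insert p X := Finset.subset_insert p X
    exact ⟨insert p X, (span_subset hA.singular.1 hsub).antisymm
      (hA.subset_of_mem (hG.isSubspace_span (hsub.trans hA.singular.1.1))
        (span_mono (by exact_mod_cast hXp)) hpS hpA (subset_span _ (by simp)))⟩

namespace IsPolarSpace

variable (hG : G.IsPolarSpace)
include hG

theorem hasDim_of_hasLength {S : Set α} {r : ℕ} (h : G.HasLength S r) : G.HasDim S (r - 1) := by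
  classical
  refine ⟨?_, ?_⟩
  -- A finite spanning set of least cardinality is independent; every finite base has as many points
  -- as the length.
  · have hex : ∃ c, ∃ X : Finset α, G.span (X : Set α) = S ∧ X.card = c :=
      (h.exists_finset hG).elim fun X hX => ⟨_, X, hX, rfl⟩
    obtain ⟨X, hX, hc⟩ := Nat.find_spec hex
    have hbase : G.IsBase (X : Set α) S := by
      have hXS : (X : Set α) ⊆ S := hX ▸ subset_span _
      refine ⟨⟨hXS.trans h.singular.1.1, fun Y hY heq => ?_⟩, hXS, hX⟩
      lift Y to Finset α using X.finite_toSet.subset hY.1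
      refine Nat.find_min hex (m := Y.card) ?_ ⟨Y, heq.trans hX, rfl⟩
      rw [← hc]
      exact Finset.card_lt_card (by exact_mod_cast hY)
    refine ⟨X, hbase, ?_⟩
    rw [(hG.hasLength_of_isBase h.singular hbase).unique h]
    ring
  · rintro e ⟨X, hX, he⟩
    have := (hG.hasLength_of_isBase h.singular hX).unique h
    omega

theorem exists_hasLength_of_hasDim {S : Set α} (hS : G.IsSingular S) {d : ℤ} (h : G.HasDim S d) :
    ∃ r : ℕ, G.HasLength S r ∧ d = r - 1 := by
  obtain ⟨r, hr⟩ := hG.exists_hasLength hS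
  exact ⟨r, hr, h.unique (hG.hasDim_of_hasLength hr)⟩

theorem hasDim_of_isHyperplane {A S : Set α} (h : G.IsHyperplane A S) {d : ℤ}
    (hd : G.HasDim S (d + 1)) : G.HasDim A d := by
  obtain ⟨r, hr, he⟩ := hG.exists_hasLength_of_hasDim h.singular hd
  obtain ⟨s, rfl, hs⟩ := hr.hyperplane A h
  have := hG.hasDim_of_hasLength hs
  rwa [show d = s - 1 by push_cast at he; linarith]

theorem hasDim_succ_of_isHyperplane {A S : Set α} (h : G.IsHyperplane A S) {d : ℤ}
    (hd : G.HasDim A d) : G.HasDim S (d + 1) := by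
  obtain ⟨r, hr, rfl⟩ := hG.exists_hasLength_of_hasDim (h.singular.mono h.subspace h.ssubset.1) hd
  have := hG.hasDim_of_hasLength (hr.step h)
  rwa [show (r : ℤ) - 1 + 1 = ((r + 1 : ℕ) : ℤ) - 1 by push_cast; ring]

theorem eq_of_hasDim {A S : Set α} (hS : G.IsSingular S) (hA : G.IsSubspace A) (hAS : A ⊆ S)
    {d : ℤ} (hAd : G.HasDim A d) (hSd : G.HasDim S d) : A = S := by
  obtain ⟨r, hr, rfl⟩ := hG.exists_hasLength_of_hasDim hS hSd
  obtain ⟨s, -, hs, heq⟩ := hr.subspace A hA hAS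
  have := hAd.unique (hG.hasDim_of_hasLength hs)
  exact heq (by omega)

theorem isHyperplane_of_hasDim {A S : Set α} (hS : G.IsSingular S) (hA : G.IsSubspace A)
    (hAS : A ⊆ S) {d : ℤ} (hAd : G.HasDim A d) (hSd : G.HasDim S (d + 1)) :
    G.IsHyperplane A S := by
  have hss : A ⊂ S := hAS.ssubset_of_ne fun e => by
    have := (e ▸ hAd).unique hSd
    omega
  obtain ⟨p, hpS, hpA⟩ := Set.exists_of_ssubset hss
  have hsub := Set.insert_subset hpS hAS
  have hspan : G.span (insert p A) ⊆ S := span_subset hS.1 hsub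
  have hsubs := hG.isSubspace_span (hsub.trans hS.1.1)
  have hyp := hG.isHyperplane_span_insert hA hpA (hS.mono hsubs hspan)
  rwa [hG.eq_of_hasDim hS hsubs hspan (hG.hasDim_succ_of_isHyperplane hyp hAd) hSd] at hyp

end IsPolarSpace

end PointLine

namespace PointLine

variable {α : Type*} {G : PointLine α}

/-! ### Duality in a top of a Grassmann space -/

namespace IsPolarSpace

variable (hG : G.IsPolarSpace)
include hG

theorem isHyperplane_of_mem_top {U h : Set α} {k : ℤ} (hU : U ∈ G.grassmannian (k + 1))
    (hh : h ∈ G.top U k) : G.IsHyperplane h U :=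
  hG.isHyperplane_of_hasDim hU.1 hh.1.1.1 hh.2 hh.1.2 hU.2

/-- A hyperplane of `U` that contains the intersection of finitely many hyperplanes of `U` belongs
to every subspace of the Grassmann space containing these hyperplanes. -/
theorem mem_of_inter_subset {U : Set α} {k : ℤ} (hU : U ∈ G.grassmannian (k + 1))
    {V : Set (Set α)} (hV : (G.grassmannSpace k).IsSubspace V) (W : Finset (Set α))
    (hW : ∀ w ∈ W, w ∈ V ∧ w ∈ G.top U k) {h : Set α} (hh : h ∈ G.top U k)
    (hsub : ∀ x ∈ U, (∀ w ∈ W, x ∈ w) → x ∈ h) : h ∈ V := by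
  classical
  induction W using Finset.induction_on generalizing h with
  | empty =>
    exact ((hG.isHyperplane_of_mem_top hU hh).ssubset.2 fun x hx => hsub x hx (by simp)).elim
  | insert w W _ ih =>
    have hW' : ∀ v ∈ W, v ∈ V ∧ v ∈ G.top U k := fun v hv => hW v (Finset.mem_insert_of_mem hv)
    obtain ⟨hwV, hwU⟩ := hW w (Finset.mem_insert_self _ _)
    by_cases hc : ∀ x ∈ U, (∀ v ∈ W, x ∈ v) → x ∈ h
    · exact ih hW' hh hc
    push Not at hc
    obtain ⟨p, hpU, hpW, hph⟩ := hc
    have hpw : p ∉ w := fun hpw => hph (hsub p hpU (by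
      intro v hv
      rcases Finset.mem_insert.1 hv with rfl | hv
      exacts [hpw, hpW v hv]))
    have hyh := hG.isHyperplane_of_mem_top hU hh
    have hyw := hG.isHyperplane_of_mem_top hU hwU
    by_cases hhw : h ⊆ w
    · exact hyh.eq_of_subset hyw hhw ▸ hwV
    have hA := hyw.inter hyh.subspace hyh.ssubset.1 hhw
    have hAd : G.HasDim (h ∩ w) (k - 1) :=
      hG.hasDim_of_isHyperplane hA (by rw [sub_add_cancel]; exact hh.1.2)
    -- On the Grassmann line through `h` and `w`, take the member through `p`. It contains the
    -- intersection of `W`, so it is in `V` by induction; with `w` it brings the whole line, and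
    -- thus `h`, into `V`.
    have hins : insert p (h ∩ w) ⊆ U := Set.insert_subset hpU (hA.ssubset.1.trans hyh.ssubset.1)
    have hgs := hG.isSubspace_span (hins.trans hU.1.1.1)
    have hgU : G.span (insert p (h ∩ w)) ⊆ U := span_subset hU.1.1 hins
    have hg := hG.isHyperplane_span_insert hA.subspace (fun h' => hph h'.1) (hU.1.mono hgs hgU)
    have hpg : p ∈ G.span (insert p (h ∩ w)) := subset_span _ (Set.mem_insert _ _)
    have hgd := hG.hasDim_succ_of_isHyperplane hg hAd
    rw [sub_add_cancel] at hgd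
    have hgV := ih hW' (h := G.span (insert p (h ∩ w))) ⟨⟨hg.singular, hgd⟩, hgU⟩ (by
      intro x hxU hxW
      have hD : G.IsSubspace {x | x ∈ U ∧ ∀ v ∈ W, x ∈ v} :=
        ⟨fun x hx => hU.1.1.1 hx.1, fun x hx z hz hxz L hL hxL hzL u hu =>
          ⟨hU.1.1.2 x hx.1 z hz.1 hxz L hL hxL hzL hu, fun v hv =>
            (hW' v hv).2.1.1.1.2 x (hx.2 v hv) z (hz.2 v hv) hxz L hL hxL hzL hu⟩⟩
      have hyD := hyw.inter hD (fun x hx => hx.1) fun h' => hpw (h' ⟨hpU, hpW⟩)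
      refine hyD.subset_of_mem hgs ?_ (p := p) ⟨hpU, hpW⟩ (fun h' => hpw h'.2) hpg ⟨hxU, hxW⟩
      rintro y ⟨⟨hyU, hyW⟩, hyw⟩
      refine subset_span _ (Set.mem_insert_of_mem _ ⟨hsub y hyU fun v hv => ?_, hyw⟩)
      rcases Finset.mem_insert.1 hv with rfl | hv
      exacts [hyw, hyW v hv])
    have hne : G.span (insert p (h ∩ w)) ≠ w := fun e => hpw (e ▸ hpg)
    refine hV.2 _ hgV w hwV hne (G.interval (h ∩ w) U k)
      ⟨h ∩ w, ⟨hh.1.1.mono hA.subspace hA.ssubset.1, hAd⟩, U, hU, hA.ssubset.1.trans hyh.ssubset.1,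
        rfl⟩ ⟨⟨hg.singular, hgd⟩, hg.ssubset.1, hgU⟩ ⟨hwU.1, Set.inter_subset_right, hwU.2⟩
      ⟨hh.1, Set.inter_subset_left, hh.2⟩

/-- Independent points of a top of the Grassmann space are hyperplanes in general position. -/
theorem exists_mem_notMem_of_isIndependent {U : Set α} {k : ℤ} (hU : U ∈ G.grassmannian (k + 1))
    {X : Set (Set α)} (hfin : X.Finite) (hXU : X ⊆ G.top U k)
    (hi : (G.grassmannSpace k).IsIndependent X) {h : Set α} (hh : h ∈ X) :
    ∃ x ∈ U, (∀ w ∈ X, w ≠ h → x ∈ w) ∧ x ∉ h := by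
  by_contra! hno
  have hfin' : (X \ {h}).Finite := hfin.subset Set.sdiff_subset
  refine hi.2 (X \ {h}) ⟨Set.sdiff_subset, fun h' => (h' hh).2 rfl⟩
    ((span_mono Set.sdiff_subset).antisymm (Set.subset_sInter fun V hV => ?_))
  refine span_subset hV.1 fun v hv => ?_
  by_cases hvh : v = h
  · subst hvh
    refine hG.mem_of_inter_subset hU hV.1 hfin'.toFinset (fun w hw => ?_) (hXU hv)
      fun x hx hxw => hno x hx fun w hw hwv => hxw w (hfin'.mem_toFinset.2 ⟨hw, hwv⟩)
    have := hfin'.mem_toFinset.1 hw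
    exact ⟨hV.2 this, hXU this.1⟩
  · exact hV.2 ⟨hv, hvh⟩

end IsPolarSpace

end PointLine

/-! ### Singular sets of signed indices -/

namespace PolarJohnson

variable {l : ℕ}

theorem IsSingular.mono {X Y : Finset (Fin l × Bool)} (hY : IsSingular Y) (h : X ⊆ Y) :
    IsSingular X :=
  fun j hj hj' => hY j (h hj) (h hj')

theorem IsSingular.insert_of_notMem {X : Finset (Fin l × Bool)} (hX : IsSingular X) {z : Fin l × Bool}
    (hz : (z.1, !z.2) ∉ X) : IsSingular (insert z X) := by
  intro j hj hj'
  rcases Finset.mem_insert.1 hj with rfl | hjX <;> rcases Finset.mem_insert.1 hj' with h | hj'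
  · simpa using congrArg Prod.snd h
  · exact hz hj'
  · subst h
    simp [hjX] at hz
  · exact hX j hjX hj'

theorem isSingular_singleton (z : Fin l × Bool) : IsSingular ({z} : Finset (Fin l × Bool)) := by
  intro j hj hj'
  rw [Finset.mem_singleton] at hj hj'
  rw [hj] at hj'
  simpa using congrArg Prod.snd hj'

theorem exists_fresh {X : Finset (Fin l × Bool)} (hX : X.card < l) : ∃ i, ∀ b, (i, b) ∉ X := by
  by_contra! h
  have : (Finset.univ : Finset (Fin l)) ⊆ X.image Prod.fst := fun i _ =>
    (h i).elim fun b hb => Finset.mem_image.2 ⟨_, hb, rfl⟩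
  have h1 := Finset.card_le_card this
  have h2 : (X.image Prod.fst).card ≤ X.card := Finset.card_image_le
  rw [Finset.card_univ, Fintype.card_fin] at h1
  omega

theorem IsSingular.exists_superset {T : Finset (Fin l × Bool)} (hT : IsSingular T) {c : ℕ}
    (hTc : T.card ≤ c) (hcl : c ≤ l) : ∃ Z, T ⊆ Z ∧ IsSingular Z ∧ Z.card = c := by
  induction c, hTc using Nat.le_induction with
  | base => exact ⟨T, subset_rfl, hT, rfl⟩
  | succ c _ ih =>
    obtain ⟨Z, hTZ, hZ, hc⟩ := ih (by omega)
    obtain ⟨i, hi⟩ := exists_fresh (X := Z) (by omega)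
    exact ⟨insert (i, true) Z, hTZ.trans (Finset.subset_insert _ _), hZ.insert_of_notMem (hi _),
      by rw [Finset.card_insert_of_notMem (hi _), hc]⟩

end PolarJohnson

namespace PointLine

variable {α : Type*} {G : PointLine α}

/-! ### Embedded polar Johnson graphs -/

/-- The vertex sets of `PJ(l, m)`. -/
def IsVertex {l : ℕ} (m : ℕ) (X : Finset (Fin l × Bool)) : Prop :=
  PolarJohnson.IsSingular X ∧ X.card = m + 1

/-- The properties of an embedding `g` of `PJ(l, m)` in the Grassmann graph of index `k` that maps
each top to hyperplanes in general position of a `(k + 1)`-dimensional singular subspace. -/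
structure IsJohnsonFamily (G : PointLine α) (k : ℤ) (l m : ℕ)
    (g : Finset (Fin l × Bool) → Set α) : Prop where
  polar : G.IsPolarSpace
  pos : 0 < m
  add_three_le : m + 3 ≤ l
  mem : ∀ X, IsVertex m X → g X ∈ G.grassmannian k
  hasDim_inter : ∀ X Y, IsVertex m X → IsVertex m Y → (X ∩ Y).card = m →
    PolarJohnson.IsSingular (X ∪ Y) → G.HasDim (g X ∩ g Y) (k - 1)
  card_inter : ∀ X Y, IsVertex m X → IsVertex m Y → G.HasDim (g X ∩ g Y) (k - 1) →
    G.Perp (g X) (g Y) → (X ∩ Y).card = m ∧ PolarJohnson.IsSingular (X ∪ Y)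
  inj : ∀ X Y, IsVertex m X → IsVertex m Y → g X = g Y → X = Y
  exists_top : ∀ Z, IsVertex (m + 1) Z → ∃ U ∈ G.grassmannian (k + 1),
    (∀ w ∈ Z, g (Z.erase w) ⊆ U) ∧
    ∀ w ∈ Z, ∃ x, (∀ v ∈ Z, v ≠ w → x ∈ g (Z.erase v)) ∧ x ∉ g (Z.erase w)

theorem IsVertex.erase {l m : ℕ} {Z : Finset (Fin l × Bool)} (hZ : IsVertex (m + 1) Z)
    {w : Fin l × Bool} (hw : w ∈ Z) : IsVertex m (Z.erase w) :=
  ⟨hZ.1.mono (Finset.erase_subset _ _), by rw [Finset.card_erase_of_mem hw, hZ.2]; rfl⟩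

theorem IsVertex.exists_insert {l m : ℕ} {X : Finset (Fin l × Bool)} (hX : IsVertex m X)
    (hl : m + 1 < l) : ∃ z ∉ X, IsVertex (m + 1) (insert z X) := by
  obtain ⟨i, hi⟩ := PolarJohnson.exists_fresh (X := X) (by rw [hX.2]; exact hl)
  exact ⟨(i, true), hi _, hX.1.insert_of_notMem (hi _),
    by rw [Finset.card_insert_of_notMem (hi _), hX.2]⟩

/-- The intersection of the subspaces `g X` over all vertices `X` with `T ⊆ X ⊆ Z`. -/
def localCore {l : ℕ} (g : Finset (Fin l × Bool) → Set α) (Z T : Finset (Fin l × Bool)) : Set α :=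
  {x | ∀ w ∈ Z, w ∉ T → x ∈ g (Z.erase w)}

/-- The intersection of the subspaces `g X` over all vertices `X` containing `T`. -/
def core {l : ℕ} (m : ℕ) (g : Finset (Fin l × Bool) → Set α) (T : Finset (Fin l × Bool)) : Set α :=
  {x | ∀ X, IsVertex m X → T ⊆ X → x ∈ g X}

theorem core_mono {l m : ℕ} {g : Finset (Fin l × Bool) → Set α} {S T : Finset (Fin l × Bool)}
    (h : S ⊆ T) : core m g S ⊆ core m g T :=
  fun _ hx X hX hTX => hx X hX (h.trans hTX)

theorem core_vertex {l m : ℕ} {g : Finset (Fin l × Bool) → Set α} {X : Finset (Fin l × Bool)}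
    (hX : IsVertex m X) : core m g X = g X := by
  refine Set.Subset.antisymm (fun x hx => hx X hX subset_rfl) fun x hx Y hY hXY => ?_
  rwa [← Finset.eq_of_subset_of_card_le hXY (by rw [hX.2, hY.2])]

namespace IsJohnsonFamily

variable {k : ℤ} {l m : ℕ} {g : Finset (Fin l × Bool) → Set α} (hF : G.IsJohnsonFamily k l m g)
include hF

theorem isHyperplane {U : Set α} (hU : U ∈ G.grassmannian (k + 1)) {X : Finset (Fin l × Bool)}
    (hX : IsVertex m X) (hXU : g X ⊆ U) : G.IsHyperplane (g X) U :=
  hF.polar.isHyperplane_of_mem_top hU ⟨hF.mem X hX, hXU⟩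

/-! ### Local cores are independent of the top -/

theorem not_subset {X Y : Finset (Fin l × Bool)} (hX : IsVertex m X) (hY : IsVertex m Y)
    (h : X ≠ Y) : ¬ g X ⊆ g Y := fun h' =>
  h (hF.inj X Y hX hY (hF.polar.eq_of_hasDim (hF.mem Y hY).1 (hF.mem X hX).1.1 h'
    (hF.mem X hX).2 (hF.mem Y hY).2))

/-- The images of two tops with a common vertex are not in the same top. -/
theorem not_common_top {X : Finset (Fin l × Bool)} (hX : IsVertex m X) {z z' : Fin l × Bool}
    (hzz : z ≠ z') (hzX : z ∉ X) (hZ : IsVertex (m + 1) (insert z X))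
    (hZ' : IsVertex (m + 1) (insert z' X)) {U : Set α} (hU : U ∈ G.grassmannian (k + 1))
    (h : ∀ w ∈ insert z X, g ((insert z X).erase w) ⊆ U)
    (h' : ∀ w ∈ insert z' X, g ((insert z' X).erase w) ⊆ U) : False := by
  have hpos := hF.pos
  -- Dropping different indices `a`, `b` from the two tops leaves vertices with at most `m - 1`
  -- common indices, yet their images are hyperplanes of one `U`, hence adjacent. Two indices exist
  -- because `m > 0`.
  obtain ⟨a, ha, b, hb, hab⟩ := Finset.one_lt_card.1 (by rw [hX.2]; omega : 1 < X.card)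
  have hY := hZ.erase (Finset.mem_insert_of_mem ha)
  have hY' := hZ'.erase (Finset.mem_insert_of_mem hb)
  have hne : (insert z X).erase a ≠ (insert z' X).erase b := by
    intro e
    have : z ∈ (insert z' X).erase b := by
      rw [← e]
      simp only [Finset.mem_erase, Finset.mem_insert, true_or, and_true]
      exact fun e => hzX (e ▸ ha)
    simp [hzz, hzX] at this
  have hYU := h a (Finset.mem_insert_of_mem ha)
  have hYU' := h' b (Finset.mem_insert_of_mem hb)
  have hyp := (hF.isHyperplane hU hY' hYU').inter (hF.mem _ hY).1.1 hYU (hF.not_subset hY hY' hne)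
  have hd := hF.polar.hasDim_of_isHyperplane hyp (d := k - 1)
    (by rw [sub_add_cancel]; exact (hF.mem _ hY).2)
  have hc := (hF.card_inter _ _ hY hY' hd fun p hp q hq =>
    hU.1.collinear hF.polar.toIsPartialLinear (hYU hp) (hYU' hq)).1
  have hsub : (insert z X).erase a ∩ (insert z' X).erase b ⊆ (X.erase a).erase b := by
    intro x hx
    simp only [Finset.mem_inter, Finset.mem_erase, Finset.mem_insert] at hx ⊢
    obtain ⟨⟨hxa, hx1⟩, hxb, hx2⟩ := hx
    refine ⟨hxb, hxa, ?_⟩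
    rcases hx1 with rfl | hx1
    · rcases hx2 with hx2 | hx2
      exacts [(hzz hx2).elim, hx2]
    · exact hx1
  have := Finset.card_le_card hsub
  rw [Finset.card_erase_of_mem (Finset.mem_erase.2 ⟨hab.symm, hb⟩), Finset.card_erase_of_mem ha,
    hX.2] at this
  omega

/-- The three images meet pairwise in dimension `k - 1`. If the intersections differ, the latter two
share a point `c` outside `g X`; both top spaces contain `g X` and `c`, so they coincide, which
`not_common_top` excludes. -/
theorem inter_subset {X : Finset (Fin l × Bool)} (hX : IsVertex m X) {z z' : Fin l × Bool}
    (hzz : z ≠ z') (hzX : z ∉ X) (hzX' : z' ∉ X)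
    (hs : PolarJohnson.IsSingular (insert z (insert z' X))) {a : Fin l × Bool} (ha : a ∈ X) :
    g X ∩ g ((insert z X).erase a) ⊆ g ((insert z' X).erase a) := by
  have hZs : insert z X ⊆ insert z (insert z' X) :=
    Finset.insert_subset_insert _ (Finset.subset_insert _ _)
  have hZs' : insert z' X ⊆ insert z (insert z' X) := Finset.subset_insert _ _
  have hZ : IsVertex (m + 1) (insert z X) :=
    ⟨hs.mono hZs, by rw [Finset.card_insert_of_notMem hzX, hX.2]⟩
  have hZ' : IsVertex (m + 1) (insert z' X) :=
    ⟨hs.mono hZs', by rw [Finset.card_insert_of_notMem hzX', hX.2]⟩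
  have hY := hZ.erase (Finset.mem_insert_of_mem ha)
  have hY' := hZ'.erase (Finset.mem_insert_of_mem ha)
  have hcard : (X.erase a).card = m := by rw [Finset.card_erase_of_mem ha, hX.2]; rfl
  have key : ∀ {P Q : Finset (Fin l × Bool)}, IsVertex m P → IsVertex m Q → P ∩ Q = X.erase a →
      P ∪ Q ⊆ insert z (insert z' X) → G.HasDim (g P ∩ g Q) (k - 1) := fun hP hQ h1 h2 =>
    hF.hasDim_inter _ _ hP hQ (by rw [h1, hcard]) (hs.mono h2)
  have hXs : X ⊆ insert z (insert z' X) := (Finset.subset_insert _ _).trans hZs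
  have hAB := key hX hY
    (by
      ext x
      simp only [Finset.mem_inter, Finset.mem_erase, Finset.mem_insert]
      tauto)
    (Finset.union_subset hXs ((Finset.erase_subset _ _).trans hZs))
  have hAC := key hX hY'
    (by
      ext x
      simp only [Finset.mem_inter, Finset.mem_erase, Finset.mem_insert]
      tauto)
    (Finset.union_subset hXs ((Finset.erase_subset _ _).trans hZs'))
  have hBC := key hY hY'
    (by
      ext x
      simp only [Finset.mem_inter, Finset.mem_erase, Finset.mem_insert]
      constructor
      · rintro ⟨⟨h1, rfl | h2⟩, -, rfl | h3⟩ <;> first | exact (hzz rfl).elim | tauto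
      · tauto)
    (Finset.union_subset ((Finset.erase_subset _ _).trans hZs) ((Finset.erase_subset _ _).trans hZs'))
  rintro b ⟨hbA, hbB⟩
  by_contra hbC
  have hA := (hF.mem _ hX).1
  have hB := (hF.mem _ hY).1
  have hC := (hF.mem _ hY').1
  have hnot : ¬ g ((insert z X).erase a) ∩ g ((insert z' X).erase a) ⊆ g X := by
    intro hsub
    have := hF.polar.eq_of_hasDim (hA.mono (hA.1.inter hB.1) Set.inter_subset_left)
      (hB.1.inter hC.1) (Set.subset_inter hsub Set.inter_subset_left) hBC hAB
    exact hbC (this.ge ⟨hbA, hbB⟩).2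
  obtain ⟨c, ⟨hcB, hcC⟩, hcA⟩ := Set.not_subset.1 hnot
  obtain ⟨U, hU, hUsub, -⟩ := hF.exists_top _ hZ
  obtain ⟨U', hU', hUsub', -⟩ := hF.exists_top _ hZ'
  have hAU : g X ⊆ U := by simpa [hzX] using hUsub z (Finset.mem_insert_self _ _)
  have hAU' : g X ⊆ U' := by simpa [hzX'] using hUsub' z' (Finset.mem_insert_self _ _)
  have hcU := hUsub a (Finset.mem_insert_of_mem ha) hcB
  have hcU' := hUsub' a (Finset.mem_insert_of_mem ha) hcC
  have hUU : U' ⊆ U := (hF.isHyperplane hU' hX hAU').subset_of_mem hU.1.1 hAU hcU' hcA hcU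
  obtain rfl := hF.polar.eq_of_hasDim hU.1 hU'.1.1 hUU hU'.2 hU.2
  exact hF.not_common_top hX hzz hzX hZ hZ' hU hUsub hUsub'

theorem localCore_subset_of_singular {X : Finset (Fin l × Bool)} (hX : IsVertex m X)
    {z z' : Fin l × Bool} (hzz : z ≠ z') (hzX : z ∉ X) (hzX' : z' ∉ X)
    (hs : PolarJohnson.IsSingular (insert z (insert z' X))) {T : Finset (Fin l × Bool)}
    (hT : T ⊆ X) : localCore g (insert z X) T ⊆ localCore g (insert z' X) T := by
  intro x hx w hw hwT
  have hxX : x ∈ g X := by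
    simpa [hzX] using hx z (Finset.mem_insert_self _ _) fun h => hzX (hT h)
  rcases Finset.mem_insert.1 hw with rfl | hw
  · rwa [Finset.erase_insert hzX']
  · exact hF.inter_subset hX hzz hzX hzX' hs hw ⟨hxX, hx w (Finset.mem_insert_of_mem hw) hwT⟩

theorem localCore_subset_of_insert {X : Finset (Fin l × Bool)} (hX : IsVertex m X)
    {z z' : Fin l × Bool} (hzX : z ∉ X) (hzX' : z' ∉ X)
    (hZ : PolarJohnson.IsSingular (insert z X)) (hZ' : PolarJohnson.IsSingular (insert z' X))
    {T : Finset (Fin l × Bool)} (hT : T ⊆ X) :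
    localCore g (insert z X) T ⊆ localCore g (insert z' X) T := by
  by_cases hzz : z = z'
  · rw [hzz]
  have hl := hF.add_three_le
  -- Opposite indices have no singular union, so the comparison passes through a third index; `m + 3
  -- ≤ l` provides one.
  by_cases hop : (z.1, !z.2) = z'
  · obtain ⟨i, hi⟩ := PolarJohnson.exists_fresh (X := insert z X)
      (by rw [Finset.card_insert_of_notMem hzX, hX.2]; omega)
    have hiz : ∀ b, (i, b) ≠ z := fun b e => hi b (e ▸ Finset.mem_insert_self _ _)
    have hiX : ∀ b, (i, b) ∉ X := fun b h => hi b (Finset.mem_insert_of_mem h)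
    have hiz' : ∀ b, (i, b) ≠ z' := by
      rintro b rfl
      exact hiz z.2 (by rw [← (Prod.mk.inj hop).1])
    have h1 : PolarJohnson.IsSingular (insert z (insert (i, true) X)) := by
      rw [Finset.insert_comm]
      exact hZ.insert_of_notMem (hi _)
    have h2 : PolarJohnson.IsSingular (insert (i, true) (insert z' X)) :=
      hZ'.insert_of_notMem (by simp [hiX, hiz'])
    exact (hF.localCore_subset_of_singular hX (hiz _).symm hzX (hiX _) h1 hT).trans
      (hF.localCore_subset_of_singular hX (hiz' _) (hiX _) hzX' h2 hT)
  · refine hF.localCore_subset_of_singular hX hzz hzX hzX' (hZ'.insert_of_notMem ?_) hT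
    rw [Finset.mem_insert]
    rintro (h | h)
    exacts [hop h, hZ z (Finset.mem_insert_self _ _) (Finset.mem_insert_of_mem h)]

theorem localCore_subset {Z Z' T : Finset (Fin l × Bool)} (hZ : IsVertex (m + 1) Z)
    (hZ' : IsVertex (m + 1) Z') (hTZ : T ⊆ Z) (hTZ' : T ⊆ Z') :
    localCore g Z T ⊆ localCore g Z' T := by
  induction hc : (Z' \ Z).card using Nat.strong_induction_on generalizing Z with
  | _ c ih =>
  by_cases hsub : Z' ⊆ Z
  · rw [Finset.eq_of_subset_of_card_le hsub (by rw [hZ.2, hZ'.2])]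
  obtain ⟨w, hwZ', hwZ⟩ := Finset.not_subset.1 hsub
  -- To keep the exchange singular, `w` replaces its own negative if that is in `Z`, and otherwise
  -- any element of `Z \ Z'`.
  obtain ⟨v, hvZ, hvZ', hv⟩ : ∃ v ∈ Z, v ∉ Z' ∧ (w.1, !w.2) ∉ Z.erase v := by
    by_cases hw : (w.1, !w.2) ∈ Z
    · exact ⟨_, hw, hZ'.1 w hwZ', Finset.notMem_erase _ _⟩
    · have : ¬ Z ⊆ Z' := fun h =>
        hsub (Finset.eq_of_subset_of_card_le h (by rw [hZ.2, hZ'.2])).ge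
      obtain ⟨v, hvZ, hvZ'⟩ := Finset.not_subset.1 this
      exact ⟨v, hvZ, hvZ', fun h => hw (Finset.mem_of_mem_erase h)⟩
  have hX := hZ.erase hvZ
  have hTX : T ⊆ Z.erase v := Finset.subset_erase.2 ⟨hTZ, fun h => hvZ' (hTZ' h)⟩
  have hwX : w ∉ Z.erase v := fun h => hwZ (Finset.mem_of_mem_erase h)
  have hs := hX.1.insert_of_notMem hv
  have hZ'' : IsVertex (m + 1) (insert w (Z.erase v)) :=
    ⟨hs, by rw [Finset.card_insert_of_notMem hwX, hX.2]⟩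
  have step := hF.localCore_subset_of_insert hX (Finset.notMem_erase v Z) hwX
    (by rw [Finset.insert_erase hvZ]; exact hZ.1) hs hTX
  rw [Finset.insert_erase hvZ] at step
  refine step.trans (ih _ ?_ hZ'' (hTX.trans (Finset.subset_insert _ _)) rfl)
  rw [← hc]
  refine Finset.card_lt_card ⟨?_, fun h => ?_⟩
  · intro x hx
    rw [Finset.mem_sdiff, Finset.mem_insert, Finset.mem_erase] at hx
    rw [Finset.mem_sdiff]
    refine ⟨hx.1, fun h => hx.2 (Or.inr ⟨?_, h⟩)⟩
    rintro rfl
    exact hvZ' hx.1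
  · have := h (Finset.mem_sdiff.2 ⟨hwZ', hwZ⟩)
    simp at this

theorem core_eq_localCore {Z T : Finset (Fin l × Bool)} (hZ : IsVertex (m + 1) Z) (hTZ : T ⊆ Z) :
    core m g T = localCore g Z T := by
  have hl := hF.add_three_le
  refine Set.Subset.antisymm (fun x hx w hw hwT =>
    hx _ (hZ.erase hw) (Finset.subset_erase.2 ⟨hTZ, hwT⟩)) fun x hx X hX hTX => ?_
  obtain ⟨z, hz, hzX⟩ := hX.exists_insert (by omega)
  have := hF.localCore_subset hZ hzX hTZ (hTX.trans (Finset.subset_insert _ _)) hx z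
    (Finset.mem_insert_self _ _) fun h => hz (hTX h)
  rwa [Finset.erase_insert hz] at this

theorem exists_vertex_superset {T : Finset (Fin l × Bool)} (hT : PolarJohnson.IsSingular T)
    (hc : T.card ≤ m + 2) : ∃ Z, T ⊆ Z ∧ IsVertex (m + 1) Z := by
  have hl := hF.add_three_le
  obtain ⟨Z, hTZ, hZ⟩ := hT.exists_superset hc (by omega)
  exact ⟨Z, hTZ, hZ⟩

/-! ### Dimensions and spans of cores -/

theorem isSubspace_core {T : Finset (Fin l × Bool)} (hT : PolarJohnson.IsSingular T)
    (hc : T.card ≤ m + 1) : G.IsSubspace (core m g T) := by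
  have hl := hF.add_three_le
  obtain ⟨X, hTX, hX⟩ := hT.exists_superset hc (by omega)
  exact ⟨fun x hx => (hF.mem X hX).1.1.1 (hx X hX hTX),
    fun x hx z hz hxz L hL hxL hzL u hu Y hY hTY =>
    (hF.mem Y hY).1.1.2 x (hx Y hY hTY) z (hz Y hY hTY) hxz L hL hxL hzL hu⟩

/-- General position in a top containing `T` and `t` gives a point missing only the hyperplane
indexed by `t`. -/
theorem exists_mem_core_singleton {T : Finset (Fin l × Bool)} {t : Fin l × Bool} (ht : t ∉ T)
    (hT : PolarJohnson.IsSingular (insert t T)) (hc : T.card ≤ m + 1) :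
    ∃ p ∈ core m g {t}, p ∉ core m g T := by
  obtain ⟨Z, hTZ, hZ⟩ := hF.exists_vertex_superset hT
    (by rw [Finset.card_insert_of_notMem ht]; omega)
  obtain ⟨htZ, hTZ⟩ := Finset.insert_subset_iff.1 hTZ
  obtain ⟨-, -, -, hgp⟩ := hF.exists_top Z hZ
  obtain ⟨p, hp, hpt⟩ := hgp t htZ
  refine ⟨p, ?_, fun h => hpt ?_⟩
  · rw [hF.core_eq_localCore hZ (Finset.singleton_subset_iff.2 htZ)]
    exact fun v hv hvt => hp v hv fun e => hvt (Finset.mem_singleton.2 e)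
  · rw [hF.core_eq_localCore hZ hTZ] at h
    exact h t htZ ht

/-- Inside a top, removing `t` from the index set means cutting with one more hyperplane of `U`, and
general position makes this cut proper. -/
theorem isHyperplane_core {T : Finset (Fin l × Bool)} {t : Fin l × Bool} (ht : t ∉ T)
    (hT : PolarJohnson.IsSingular (insert t T)) (hc : T.card ≤ m) :
    G.IsHyperplane (core m g T) (core m g (insert t T)) := by
  have hc' : (insert t T).card ≤ m + 1 := by rw [Finset.card_insert_of_notMem ht]; omega
  obtain ⟨Z, hTZ, hZ⟩ := hF.exists_vertex_superset hT (by omega)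
  obtain ⟨htZ, hTZ'⟩ := Finset.insert_subset_iff.1 hTZ
  obtain ⟨U, hU, hUsub, -⟩ := hF.exists_top Z hZ
  obtain ⟨v, hvZ, hvT⟩ : ∃ v ∈ Z, v ∉ insert t T := by
    by_contra! h
    have := Finset.card_le_card h
    rw [hZ.2] at this
    omega
  have hsub : core m g (insert t T) ⊆ U := fun x hx =>
    hUsub v hvZ (hx _ (hZ.erase hvZ) (Finset.subset_erase.2 ⟨hTZ, hvT⟩))
  have heq : core m g T = core m g (insert t T) ∩ g (Z.erase t) := by
    rw [hF.core_eq_localCore hZ hTZ, hF.core_eq_localCore hZ hTZ']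
    ext x
    refine ⟨fun hx => ⟨fun w hw hwT => hx w hw fun h => hwT (Finset.mem_insert_of_mem h),
      hx t htZ ht⟩, fun hx w hw hwT => ?_⟩
    by_cases hwt : w = t
    · exact hwt ▸ hx.2
    · exact hx.1 w hw (by simp [hwt, hwT])
  obtain ⟨p, hp, hpT⟩ := hF.exists_mem_core_singleton ht hT (by omega)
  have hpi : p ∈ core m g (insert t T) := core_mono (by simp) hp
  rw [heq] at hpT ⊢
  exact (hF.isHyperplane hU (hZ.erase htZ) (hUsub t htZ)).inter (hF.isSubspace_core hT hc') hsub
    fun h => hpT ⟨hpi, h hpi⟩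

theorem core_mem_grassmannian {T : Finset (Fin l × Bool)} (hT : PolarJohnson.IsSingular T)
    (hc : T.card ≤ m + 1) : core m g T ∈ G.grassmannian (k - m - 1 + T.card) := by
  have hl := hF.add_three_le
  -- Descending from the vertices, whose dimension is known, each removed index costs one dimension.
  induction hj : m + 1 - T.card generalizing T with
  | zero =>
    have hX : IsVertex m T := ⟨hT, by omega⟩
    have := hF.mem T hX
    rwa [core_vertex hX, hX.2, show k - m - 1 + ((m + 1 : ℕ) : ℤ) = k by push_cast; ring]
  | succ j ih =>
    obtain ⟨i, hi⟩ := PolarJohnson.exists_fresh (X := T) (by omega)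
    have hT' := hT.insert_of_notMem (z := (i, true)) (hi _)
    have hcard : (insert (i, true) T).card = T.card + 1 := Finset.card_insert_of_notMem (hi _)
    have hyp := hF.isHyperplane_core (hi true) hT' (by omega)
    have := ih hT' (by omega) (by omega)
    rw [hcard] at this
    refine ⟨this.1.mono hyp.subspace hyp.ssubset.1, hF.polar.hasDim_of_isHyperplane hyp ?_⟩
    rw [show k - m - 1 + (T.card : ℤ) + 1 = k - m - 1 + ((T.card + 1 : ℕ) : ℤ) by push_cast; ring]
    exact this.2

theorem core_subset_span {X : Finset (Fin l × Bool)} (hX : IsVertex m X)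
    {T : Finset (Fin l × Bool)} (hTX : T ⊆ X) :
    core m g T ⊆ G.span (⋃ z ∈ X, core m g {z}) := by
  have hspan : G.IsSubspace (G.span (⋃ z ∈ X, core m g {z})) :=
    hF.polar.isSubspace_span (Set.iUnion₂_subset fun z _ =>
      (hF.isSubspace_core (PolarJohnson.isSingular_singleton z) (by simp)).1)
  have hle : ∀ z ∈ X, core m g {z} ⊆ G.span (⋃ z ∈ X, core m g {z}) := fun z hz =>
    (Set.subset_iUnion₂ (s := fun z (_ : z ∈ X) => core m g {z}) z hz).trans (subset_span _)
  induction T using Finset.induction_on with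
  | empty =>
    obtain ⟨z, hz⟩ := Finset.card_pos.1 (by rw [hX.2]; omega : 0 < X.card)
    exact (core_mono (Finset.empty_subset _)).trans (hle z hz)
  | insert t T ht ih =>
    have hc := Finset.card_le_card hTX
    rw [Finset.card_insert_of_notMem ht, hX.2] at hc
    have hT := hX.1.mono hTX
    obtain ⟨htX, hTX'⟩ := Finset.insert_subset_iff.1 hTX
    obtain ⟨p, hp, hpT⟩ := hF.exists_mem_core_singleton ht hT (by omega)
    exact (hF.isHyperplane_core ht hT (by omega)).subset_of_mem hspan (ih hTX')
      (core_mono (by simp) hp) hpT (hle t htX hp)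

theorem eq_span {X : Finset (Fin l × Bool)} (hX : IsVertex m X) :
    g X = G.span (⋃ z ∈ X, core m g {z}) := by
  refine Set.Subset.antisymm ?_ (span_subset (hF.mem X hX).1.1 (Set.iUnion₂_subset fun z hz x hx =>
    hx X hX (Finset.singleton_subset_iff.2 hz)))
  exact (core_vertex hX).ge.trans (hF.core_subset_span hX subset_rfl)

/-- Complete `j` to a vertex `A ∪ {j}`. Since the core of `A` is a hyperplane of the images of both
`A ∪ {j}` and `A ∪ {-j}`, one collinear pair of points outside it makes these images perpendicular,
hence adjacent; but the union of the two vertices is not singular. -/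
theorem not_perp_core (j : Fin l × Bool) :
    ¬ G.Perp (core m g {j}) (core m g {(j.1, !j.2)}) := by
  intro hperp
  have hl := hF.add_three_le
  obtain ⟨X, hjX, hX⟩ :=
    (PolarJohnson.isSingular_singleton j).exists_superset (c := m + 1) (by simp) (by omega)
  rw [Finset.singleton_subset_iff] at hjX
  set A := X.erase j with hA
  have hAj : insert j A = X := Finset.insert_erase hjX
  have hjA : j ∉ A := Finset.notMem_erase _ _
  have hcard : A.card = m := by rw [hA, Finset.card_erase_of_mem hjX, hX.2]; rfl
  have hAs : PolarJohnson.IsSingular A := hX.1.mono (Finset.erase_subset _ _)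
  have hj'A : (j.1, !j.2) ∉ A := fun h => hX.1 j hjX (Finset.mem_of_mem_erase h)
  have hs' : PolarJohnson.IsSingular (insert (j.1, !j.2) A) :=
    hAs.insert_of_notMem (by simpa using hjA)
  have hX' : IsVertex m (insert (j.1, !j.2) A) :=
    ⟨hs', by rw [Finset.card_insert_of_notMem hj'A, hcard]⟩
  have hyp := hF.isHyperplane_core hjA (hAj ▸ hX.1) hcard.le
  have hyp' := hF.isHyperplane_core hj'A hs' hcard.le
  obtain ⟨p, hp, hpA⟩ := hF.exists_mem_core_singleton hjA (hAj ▸ hX.1) (by omega)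
  obtain ⟨p', hp', hpA'⟩ := hF.exists_mem_core_singleton hj'A hs' (by omega)
  have hpX : p ∈ core m g (insert j A) := core_mono (by simp) hp
  have hpX' : p' ∈ core m g (insert (j.1, !j.2) A) := core_mono (by simp) hp'
  rw [hAj, core_vertex hX] at hyp hpX
  rw [core_vertex hX'] at hyp' hpX'
  have hpl := hF.polar.toIsPartialLinear
  have h1 : ∀ q ∈ g (insert (j.1, !j.2) A), G.Collinear p q :=
    hyp'.subset_of_mem (hF.polar.isSubspace_perp p)
      (fun a ha => hyp.singular.collinear hpl hpX (hyp.ssubset.1 ha)) hpX' hpA' (hperp p hp p' hp')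
  have h2 : G.Perp (g X) (g (insert (j.1, !j.2) A)) := fun x hx q hq =>
    (hyp.subset_of_mem (hF.polar.isSubspace_perp q)
      (fun a ha => hyp'.singular.collinear hpl hq (hyp'.ssubset.1 ha)) hpX hpA (h1 q hq).symm hx).symm
  have hne : X ≠ insert (j.1, !j.2) A := fun e =>
    hX.1 j hjX (e ▸ Finset.mem_insert_self _ _)
  have hinter : g X ∩ g (insert (j.1, !j.2) A) = core m g A := by
    refine Set.Subset.antisymm (fun x hx => ?_) (Set.subset_inter hyp.ssubset.1 hyp'.ssubset.1)
    by_contra hxA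
    exact hF.not_subset hX hX' hne (hyp.subset_of_mem hyp'.singular.1 hyp'.ssubset.1 hx.1 hxA hx.2)
  have hd := (hF.core_mem_grassmannian hAs (by omega)).2
  rw [hcard, show k - m - 1 + (m : ℤ) = k - 1 by ring, ← hinter] at hd
  exact (hF.card_inter X _ hX hX' hd h2).2 j (Finset.mem_union_left _ hjX)
    (Finset.mem_union_right _ (Finset.mem_insert_self _ _))

/-! ### The frame of singleton cores -/

theorem core_empty_mem : core m g ∅ ∈ G.grassmannian (k - m - 1) := by
  simpa using hF.core_mem_grassmannian (T := ∅) (fun j hj => by simp at hj) (by simp)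

theorem core_singleton_mem (j : Fin l × Bool) : core m g {j} ∈ G.grassmannian (k - m) := by
  have := hF.core_mem_grassmannian (PolarJohnson.isSingular_singleton j) (by simp)
  rwa [Finset.card_singleton, show k - m - 1 + ((1 : ℕ) : ℤ) = k - m by push_cast; ring] at this

theorem collinear_core {i j : Fin l × Bool} (h : (j.1, !j.2) ≠ i) :
    (G.residue (core m g ∅) (k - m)).Collinear (core m g {j}) (core m g {i}) := by
  have hpos := hF.pos
  have hl := hF.add_three_le
  have hs : PolarJohnson.IsSingular ({i, j} : Finset (Fin l × Bool)) := by
    rw [Finset.pair_comm]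
    refine (PolarJohnson.isSingular_singleton i).insert_of_notMem ?_
    rwa [Finset.mem_singleton]
  -- As `i = j` is allowed, the pair is enlarged to exactly two indices; their core is the upper end
  -- of the line, and `m > 0` gives `2 ≤ m + 1`.
  obtain ⟨T, hT, hTs, hTc⟩ := hs.exists_superset (c := 2) Finset.card_le_two (by omega)
  have hU := hF.core_mem_grassmannian hTs (by omega)
  rw [hTc, show k - m - 1 + ((2 : ℕ) : ℤ) = k - m + 1 by push_cast; ring] at hU
  refine ⟨G.interval (core m g ∅) (core m g T) (k - m), ⟨⟨_, hF.core_empty_mem, _, hU,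
    core_mono (Finset.empty_subset _), rfl⟩, fun X hX => ⟨hX.1, hX.2.1⟩⟩,
    ⟨hF.core_singleton_mem j, core_mono (Finset.empty_subset _), core_mono ?_⟩,
    ⟨hF.core_singleton_mem i, core_mono (Finset.empty_subset _), core_mono ?_⟩⟩
  · exact (Finset.singleton_subset_iff.2 (by simp)).trans hT
  · exact (Finset.singleton_subset_iff.2 (by simp)).trans hT

theorem not_collinear_core (N : Set α) (j : Fin l × Bool) :
    ¬ (G.residue N (k - m)).Collinear (core m g {j}) (core m g {(j.1, !j.2)}) := by
  rintro ⟨_, ⟨⟨S, -, U, hU, -, rfl⟩, -⟩, h1, h2⟩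
  exact hF.not_perp_core j fun p hp q hq =>
    hU.1.collinear hF.polar.toIsPartialLinear (h1.2.2 hp) (h2.2.2 hq)

theorem core_singleton_injective : Function.Injective fun j : Fin l × Bool => core m g {j} := by
  intro i j hij
  by_contra hne
  by_cases h : (i.1, !i.2) = j
  · refine hF.not_perp_core i fun p hp q hq => ?_
    have hq' : q ∈ core m g {i} := by
      rw [h] at hq
      exact hij.ge hq
    exact (hF.core_singleton_mem i).1.collinear hF.polar.toIsPartialLinear hp hq'
  · have hs : PolarJohnson.IsSingular (insert i {j} : Finset (Fin l × Bool)) :=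
      (PolarJohnson.isSingular_singleton j).insert_of_notMem (by rwa [Finset.mem_singleton])
    obtain ⟨p, hp, hp'⟩ := hF.exists_mem_core_singleton (by simpa using hne) hs (by simp)
    exact hp' (hij.le hp)

theorem isFrame : (G.residue (core m g ∅) (k - m)).IsFrame l
    (Set.range fun j : Fin l × Bool => core m g {j}) := by
  refine ⟨?_, ?_, ?_⟩
  · rintro _ ⟨j, rfl⟩
    exact ⟨hF.core_singleton_mem j, hF.core_singleton_mem j, core_mono (Finset.empty_subset _)⟩
  · rw [← Set.image_univ, hF.core_singleton_injective.encard_image, Set.encard_univ]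
    simp [mul_comm]
  · rintro _ ⟨j, rfl⟩
    refine ⟨core m g {(j.1, !j.2)}, ⟨⟨_, rfl⟩, hF.not_collinear_core _ j⟩, ?_⟩
    rintro _ ⟨⟨i, rfl⟩, hi⟩
    by_contra hne
    exact hi (hF.collinear_core fun e => hne (by rw [e]))

end IsJohnsonFamily

/-! ### From the embedding to a family indexed by finite sets -/

open Classical in
/-- The map on finite sets of signed indices given by a map on the vertices of `PJ(l, m)`. -/
noncomputable def extendVertex {l m : ℕ} (f : PolarJohnson.Vertex l m → Set α)
    (X : Finset (Fin l × Bool)) : Set α :=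
  if h : PolarJohnson.IsSingular X ∧ X.card = m + 1 then f ⟨X, h⟩ else ∅

theorem extendVertex_of_isVertex {l m : ℕ} (f : PolarJohnson.Vertex l m → Set α)
    {X : Finset (Fin l × Bool)} (hX : IsVertex m X) : extendVertex f X = f ⟨X, hX⟩ :=
  dif_pos hX

theorem isJohnsonFamily_extendVertex (hG : G.IsPolarSpace) {n k l m : ℕ} (hm : 0 < m)
    (hlm : (3 : ℤ) ≤ (l : ℤ) - m)
    (f : PolarJohnson.graph l m ↪g G.grassmannGraph n k)
    (hf : ∀ Z : PolarJohnson.Vertex l (m + 1),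
      (G.grassmannSpace k).IsIndependent ((fun X => (f X : Set α)) '' PolarJohnson.top Z) ∧
      ∃ U ∈ G.grassmannian ((k : ℤ) + 1),
        (fun X => (f X : Set α)) '' PolarJohnson.top Z ⊆ G.top U k) :
    G.IsJohnsonFamily k l m (extendVertex fun X => (f X : Set α)) where
  polar := hG
  pos := hm
  add_three_le := by omega
  mem X hX := by
    rw [extendVertex_of_isVertex _ hX]
    exact (f _).2
  hasDim_inter X Y hX hY hc hs := by
    rw [extendVertex_of_isVertex _ hX, extendVertex_of_isVertex _ hY]
    have : (PolarJohnson.graph l m).Adj ⟨X, hX⟩ ⟨Y, hY⟩ := ⟨hc, fun _ => hs⟩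
    exact (f.map_rel_iff.2 this).1
  card_inter X Y hX hY hd hp := by
    rw [extendVertex_of_isVertex _ hX, extendVertex_of_isVertex _ hY] at hd hp
    have : (G.grassmannGraph n k).Adj (f ⟨X, hX⟩) (f ⟨Y, hY⟩) := ⟨hd, fun _ => hp⟩
    have := f.map_rel_iff.1 this
    exact ⟨this.1, this.2 (by omega)⟩
  inj X Y hX hY h := by
    rw [extendVertex_of_isVertex _ hX, extendVertex_of_isVertex _ hY] at h
    exact congrArg Subtype.val (f.injective (Subtype.ext h))
  exists_top Z hZ := by
    obtain ⟨hi, U, hU, hsub⟩ := hf ⟨Z, hZ⟩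
    have hmem : ∀ w (hw : w ∈ Z), (f ⟨Z.erase w, hZ.erase hw⟩ : Set α) ∈
        (fun X => (f X : Set α)) '' PolarJohnson.top ⟨Z, hZ⟩ := fun w hw =>
      ⟨_, Finset.erase_subset _ _, rfl⟩
    refine ⟨U, hU, fun w hw => ?_, fun w hw => ?_⟩
    · rw [extendVertex_of_isVertex _ (hZ.erase hw)]
      exact (hsub (hmem w hw)).2
    · obtain ⟨x, -, hx, hxw⟩ :=
        hG.exists_mem_notMem_of_isIndependent hU (Set.toFinite _) hsub hi (hmem w hw)
      refine ⟨x, fun v hv hvw => ?_, ?_⟩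
      · rw [extendVertex_of_isVertex _ (hZ.erase hv)]
        refine hx _ (hmem v hv) fun e => ?_
        have h1 : Z.erase v = Z.erase w := congrArg Subtype.val (f.injective (Subtype.ext e))
        have h2 : v ∈ Z.erase w := Finset.mem_erase.2 ⟨hvw, hv⟩
        rw [← h1] at h2
        exact Finset.notMem_erase _ _ h2
      · rwa [extendVertex_of_isVertex _ (hZ.erase hw)]

end PointLine

theorem theorem4p4 {α : Type*} (G : PointLine α) (hG : G.IsPolarSpace)
    (n k l m : ℕ) (hn : G.HasRank n)
    (hm : 0 < m) (hmk : m ≤ k) (hln : l ≤ n)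
    (hlm : (3 : ℤ) ≤ (l : ℤ) - m) (hnk : (l : ℤ) - m ≤ (n : ℤ) - k)
    (f : PolarJohnson.graph l m ↪g G.grassmannGraph n k)
    (hf : ∀ Z : PolarJohnson.Vertex l (m + 1),
      (G.grassmannSpace k).IsIndependent ((fun X => (f X : Set α)) '' PolarJohnson.top Z) ∧
      ∃ U ∈ G.grassmannian ((k : ℤ) + 1),
        (fun X => (f X : Set α)) '' PolarJohnson.top Z ⊆ G.top U k) :
    ∃ N ∈ G.grassmannian ((k : ℤ) - m - 1),
      (∀ X, (f X : Set α) ∈ G.parabolic N k) ∧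
      ∃ B : Set (Set α), (G.residue N ((k : ℤ) - m)).IsFrame l B ∧
        ∀ X, ∃ C ⊆ B, (f X : Set α) = G.span (⋃₀ C) := by
  have hF := PointLine.isJohnsonFamily_extendVertex hG hm hlm f hf
  refine ⟨_, hF.core_empty_mem, fun X => ⟨(f X).2, fun x hx => ?_⟩, _, hF.isFrame, fun X =>
    ⟨(fun j => PointLine.core m _ {j}) '' (X.1 : Set (Fin l × Bool)), Set.image_subset_range _ _, ?_⟩⟩
  · have := hx X.1 X.2 (Finset.empty_subset _)
    rwa [PointLine.extendVertex_of_isVertex _ X.2] at this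
  · have := hF.eq_span X.2
    rw [PointLine.extendVertex_of_isVertex _ X.2] at this
    rw [Set.sUnion_image]
    exact this
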